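/- **Setting.** Fix an integer $p\ge 2$ and a unit vector $\theta\in\mathcal S^{p-1}=\{x\in\mathbb R^p:\|x\|=1\}$. Let $\mathcal F$ be the class of functions $f:\mathbb R\to[0,\infty)$ that are monotone increasing (not necessarily strictly), twice differentiable at $0$ (differentiable near $0$, with $f'$ differentiable at $0$) and satisfy $f(0)=f'(0)=1$. For $f\in\mathcal F$ and $\kappa\in\mathbb R$, let $\mathrm P^{(n)}_{\theta,\kappa,f}$ be the joint law of a random sample $X_{n1},\dots,X_{nn}$ from the distribution on $\mathcal S^{p-1}$ whose density with respect to surface area measure is proportional to $x\mapsto f(\kappa (x'\theta)^2)$. Let $\mathrm P^{(n)}_0=\mathrm P^{(n)}_{\theta,0,f}$ be the law of a random sample of size $n$ from the uniform distribution on $\mathcal S^{p-1}$. Put $$\Delta^{(n)}_\theta=\frac{p}{\sqrt n}\sum_{i=1}^n\Big\{(X_{ni}'\theta)^2-\frac1p\Big\},\qquad \Gamma_p=\frac{2(p-1)}{p+2},\qquad S_n=\frac1n\sum_{i=1}^n X_{ni}X_{ni}'.$$ **Theorem.** Let $p$ and $\theta$ be as above and let $f\in\mathcal F$. 1. Let $\kappa_n=\tau_n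 p/\sqrt n$, where the real sequence $(\tau_n)$ is $O(1)$ but not $o(1)$. Then, as $n\to\infty$ under $\mathrm P_0^{(n)}$, $$\log\frac{d\mathrm P^{(n)}_{\theta,\kappa_n,f}}{d\mathrm P^{(n)}_0}=\tau_n\Delta^{(n)}_\theta-\frac{\tau_n^2}{2}\Gamma_p+o_{\mathrm P}(1).$$ 2. Under $\mathrm P_0^{(n)}$, $\Delta^{(n)}_\theta$ converges in distribution to $\mathcal N(0,\Gamma_p)$. 3. The sequence of models $\{\mathrm P^{(n)}_{\theta,\kappa,f}:\kappa\in\mathbb R\}$ is locally asymptotically normal at $\kappa=0$ with central sequence $\Delta^{(n)}_\theta$ and Fisher information $\Gamma_p$. That is, all $\mathrm P^{(n)}_{\theta,\kappa,f}$ are probability measures, the expansion in 1 holds with $\kappa_n=\tau_np/\sqrt n$ for every bounded real sequence $(\tau_n)$, and 2 holds. 4. The contiguity rate is $1/\sqrt n$, in the following sense. If $\kappa_n=O(1/\sqrt n)$, then $\mathrm P^{(n)}_{\theta,\kappa_n,f}$ and $\mathrm P^{(n)}_0$ are mutually contiguous. If $\kappa_n=\tau/\sqrt n$ with a real constant $\tau\neq0$,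 then for every $\alpha\in(0,1)$ there is a sequence of tests of $\mathrm P_0^{(n)}$ with asymptotic level $\alpha$ whose power under $\mathrm P^{(n)}_{\theta,\kappa_n,f}$ converges to a limit in $(\alpha,1)$. 5. One has $\Delta^{(n)}_\theta=\sqrt n\,(p\,\theta'S_n\theta-1)$. Moreover, let $\alpha\in(0,1)$, let $z_\alpha$ be the upper $\alpha$-quantile of $\mathcal N(0,1)$ and put $T^{(n)}_\theta=\Delta^{(n)}_\theta/\sqrt{\Gamma_p}$. Then the test of $\mathrm P^{(n)}_0$ that rejects when $T^{(n)}_\theta>z_\alpha$ is locally asymptotically most powerful at asymptotic level $\alpha$ against $\bigcup_{\kappa>0}\bigcup_{g\in\mathcal F}\{\mathrm P^{(n)}_{\theta,\kappa,g}\}$, and the test that rejects when $T^{(n)}_\theta<-z_\alpha$ is so against $\bigcup_{\kappa<0}\bigcup_{g\in\mathcal F}\{\mathrm P^{(n)}_{\theta,\kappa,g}\}$. This means that the null rejection probability of the test converges to $\alpha$ and that, for every sequence of (possibly randomized) tests $\psi_n$ with $\limsup_n \mathrm E_{\mathrm P_0^{(n)}}[\psi_n]\le\alpha$, every $g\in\mathcal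 F$ and every bounded sequence $(\tau_n)$ of positive (respectively, negative) numbers, the power of $\psi_n$ minus that of the test, under $\mathrm P^{(n)}_{\theta,\kappa_n,g}$ with $\kappa_n=\tau_np/\sqrt n$, has a nonpositive limit superior. -/

import Mathlib

open MeasureTheory ProbabilityTheory Filter Topology Asymptotics
open scoped NNReal ENNReal Matrix

noncomputable section

/-! General asymptotic statistics: sequences of measures on varying sample spaces. -/

section Asymptotics

/-- `Y n = o_P(1)` as `n → ∞` under the sequence of measures `P n`. -/
def IsLittleOP {Ω : ℕ → Type} [∀ n, MeasurableSpace (Ω n)]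
    (P : ∀ n, Measure (Ω n)) (Y : ∀ n, Ω n → ℝ) : Prop :=
  ∀ ε : ℝ, 0 < ε → Tendsto (fun n => P n {x | ε ≤ |Y n x|}) atTop (𝓝 0)

/-- Under `P n`, the statistic `T n` is asymptotically normal with mean zero and variance `v`. -/
def IsAsymptoticallyNormal {Ω : ℕ → Type} [∀ n, MeasurableSpace (Ω n)]
    (P : ∀ n, Measure (Ω n)) (T : ∀ n, Ω n → ℝ) (v : ℝ) : Prop :=
  0 ≤ v ∧ ∃ _ : ∀ n, IsProbabilityMeasure (P n),
    TendstoInDistribution T atTop (id : ℝ → ℝ) P (gaussianReal 0 v.toNNReal)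

/-- `Q n` is contiguous to `P n`. -/
def IsContiguous {Ω : ℕ → Type} [∀ n, MeasurableSpace (Ω n)]
    (Q P : ∀ n, Measure (Ω n)) : Prop :=
  ∀ A : ∀ n, Set (Ω n), (∀ n, MeasurableSet (A n)) →
    Tendsto (fun n => P n (A n)) atTop (𝓝 0) → Tendsto (fun n => Q n (A n)) atTop (𝓝 0)

/-- A sequence of (possibly randomized) tests: `φ n x` is the probability of rejecting the null
hypothesis when `x` is observed. -/
def IsTestSequence {Ω : ℕ → Type} [∀ n, MeasurableSpace (Ω n)] (φ : ∀ n, Ω n → ℝ) : Prop :=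
  ∀ n, Measurable (φ n) ∧ ∀ x, φ n x ∈ Set.Icc (0 : ℝ) 1

/-- The sequence of models `{P n κ : κ ∈ ℝ}` is locally asymptotically normal at `κ = 0`, for local
parameter values `κ = r n * τ n` with `τ` bounded, with central sequence `Δ` and Fisher
information `Γ`. -/
structure IsLANAtZero {Ω : ℕ → Type} [∀ n, MeasurableSpace (Ω n)]
    (P : ∀ n, ℝ → Measure (Ω n)) (r : ℕ → ℝ) (Δ : ∀ n, Ω n → ℝ) (Γ : ℝ) : Prop where
  isProbabilityMeasure : ∀ n κ, IsProbabilityMeasure (P n κ)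
  expansion : ∀ τ : ℕ → ℝ, τ =O[atTop] (fun _ => (1 : ℝ)) →
    IsLittleOP (fun n => P n 0) (fun n x =>
      llr (P n (r n * τ n)) (P n 0) x - (τ n * Δ n x - (τ n) ^ 2 / 2 * Γ))
  normal : IsAsymptoticallyNormal (fun n => P n 0) Δ Γ

/-- `r` is the contiguity rate at `κ = 0` for `{P n κ : κ ∈ ℝ}`: parameter values that are `O(r n)`
are mutually contiguous to `κ = 0`, while at `κ = τ * r n` with `τ ≠ 0` there are, for each
`α ∈ (0, 1)`, tests of asymptotic level `α` whose asymptotic power lies in `(α, 1)`. -/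
structure IsContiguityRateAtZero {Ω : ℕ → Type} [∀ n, MeasurableSpace (Ω n)]
    (P : ∀ n, ℝ → Measure (Ω n)) (r : ℕ → ℝ) : Prop where
  contiguous : ∀ κ : ℕ → ℝ, κ =O[atTop] r →
    IsContiguous (fun n => P n (κ n)) (fun n => P n 0) ∧
      IsContiguous (fun n => P n 0) (fun n => P n (κ n))
  detectable : ∀ τ : ℝ, τ ≠ 0 → ∀ α ∈ Set.Ioo (0 : ℝ) 1,
    ∃ φ : ∀ n, Ω n → ℝ, IsTestSequence φ ∧
      Tendsto (fun n => ∫ x, φ n x ∂(P n 0)) atTop (𝓝 α) ∧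
      ∃ β ∈ Set.Ioo α 1, Tendsto (fun n => ∫ x, φ n x ∂(P n (τ * r n))) atTop (𝓝 β)

/-- The sequence of tests `φ` of the null hypotheses `P₀ n` has asymptotic level `α` and is
asymptotically most powerful, among all sequences of tests of asymptotic level at most `α`, against
each sequence of alternatives in the class `A`. -/
structure IsAsymptoticallyMostPowerful {Ω : ℕ → Type} [∀ n, MeasurableSpace (Ω n)]
    (P₀ : ∀ n, Measure (Ω n)) (A : Set (∀ n, Measure (Ω n))) (α : ℝ)
    (φ : ∀ n, Ω n → ℝ) : Prop where
  isTest : IsTestSequence φ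
  level : Tendsto (fun n => ∫ x, φ n x ∂(P₀ n)) atTop (𝓝 α)
  optimal : ∀ ψ : ∀ n, Ω n → ℝ, IsTestSequence ψ →
    (∀ ε : ℝ, 0 < ε → ∀ᶠ n in atTop, ∫ x, ψ n x ∂(P₀ n) ≤ α + ε) →
    ∀ Q ∈ A, ∀ ε : ℝ, 0 < ε →
      ∀ᶠ n in atTop, ∫ x, ψ n x ∂(Q n) ≤ ∫ x, φ n x ∂(Q n) + ε

end Asymptotics

/-! Axial rotationally symmetric distributions on the unit sphere of `ℝ^p`. -/

section Axial

/-- The unit sphere of `ℝ^p`. -/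
abbrev UnitSphere (p : ℕ) : Type := Metric.sphere (0 : EuclideanSpace ℝ (Fin p)) 1

/-- The surface area measure on the unit sphere of `ℝ^p`. -/
def surfaceMeasure (p : ℕ) : Measure (UnitSphere p) :=
  (volume : Measure (EuclideanSpace ℝ (Fin p))).toSphere

/-- The uniform distribution on the unit sphere of `ℝ^p`. -/
def uniformLaw (p : ℕ) : Measure (UnitSphere p) :=
  (surfaceMeasure p Set.univ)⁻¹ • surfaceMeasure p

/-- The class of angular functions: nonnegative, monotone increasing, twice differentiable at `0`,
with `f 0 = f' 0 = 1`. -/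
structure IsAngularFunction (f : ℝ → ℝ) : Prop where
  nonneg : ∀ x, 0 ≤ f x
  monotone : Monotone f
  differentiableNear : ∀ᶠ x in 𝓝 (0 : ℝ), DifferentiableAt ℝ f x
  twiceDifferentiableAt : DifferentiableAt ℝ (deriv f) 0
  map_zero : f 0 = 1
  deriv_zero : deriv f 0 = 1

/-- The unnormalized axial density `x ↦ f (κ (x'θ)²)` on the sphere. -/
def axialWeight {p : ℕ} (θ : UnitSphere p) (κ : ℝ) (f : ℝ → ℝ) (x : UnitSphere p) : ℝ≥0∞ :=
  ENNReal.ofReal (f (κ * (inner ℝ (x : EuclideanSpace ℝ (Fin p)) θ) ^ 2))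

/-- The axial distribution with location `θ`, concentration `κ` and angular function `f`: its
density with respect to the surface area measure is `x ↦ f (κ (x'θ)²)`, divided by the integral of
this function over the sphere. -/
def axialLaw {p : ℕ} (θ : UnitSphere p) (κ : ℝ) (f : ℝ → ℝ) : Measure (UnitSphere p) :=
  (surfaceMeasure p).withDensity
    (fun x => axialWeight θ κ f x / ∫⁻ y, axialWeight θ κ f y ∂(surfaceMeasure p))

/-- The joint law of a random sample of size `n` from the uniform distribution. -/
def nullLaw (p n : ℕ) : Measure (Fin n → UnitSphere p) :=
  Measure.pi (fun _ => uniformLaw p)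

/-- The joint law of a random sample of size `n` from `axialLaw θ κ f`, for `κ ≠ 0`; for `κ = 0` it
is set to be the null law. -/
def sampleLaw {p : ℕ} (θ : UnitSphere p) (f : ℝ → ℝ) (n : ℕ) (κ : ℝ) :
    Measure (Fin n → UnitSphere p) :=
  if κ = 0 then nullLaw p n else Measure.pi (fun _ => axialLaw θ κ f)

/-- The central sequence `Δ_θ = (p / √n) ∑ i, ((x_i'θ)² - 1 / p)`. -/
def centralSequence {p : ℕ} (θ : UnitSphere p) (n : ℕ) (x : Fin n → UnitSphere p) : ℝ :=
  (p / √(n : ℝ)) *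
    ∑ i, ((inner ℝ (x i : EuclideanSpace ℝ (Fin p)) θ) ^ 2 - 1 / (p : ℝ))

/-- The Fisher information `Γ_p = 2 (p - 1) / (p + 2)`. -/
def fisherInfo (p : ℕ) : ℝ := 2 * ((p : ℝ) - 1) / ((p : ℝ) + 2)

/-- The sample covariance matrix `S_n = n⁻¹ ∑ i, x_i x_i'` with respect to the origin. -/
def sampleCov {p n : ℕ} (x : Fin n → UnitSphere p) : Matrix (Fin p) (Fin p) ℝ :=
  (n : ℝ)⁻¹ • ∑ i, Matrix.vecMulVec (x i : EuclideanSpace ℝ (Fin p)).ofLp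
    (x i : EuclideanSpace ℝ (Fin p)).ofLp

/-- The test statistic `T_θ = Δ_θ / √Γ_p`. -/
def testStat {p : ℕ} (θ : UnitSphere p) (n : ℕ) (x : Fin n → UnitSphere p) : ℝ :=
  centralSequence θ n x / √(fisherInfo p)

/-- Sequences of local alternatives `κ_n = τ_n p / √n`, with a bounded sequence `τ` all of whose
terms lie in `s`, and with an arbitrary fixed angular function. -/
def localAlternatives {p : ℕ} (θ : UnitSphere p) (s : Set ℝ) :
    Set (∀ n, Measure (Fin n → UnitSphere p)) :=
  {Q | ∃ f : ℝ → ℝ, IsAngularFunction f ∧ ∃ τ : ℕ → ℝ, τ =O[atTop] (fun _ => (1 : ℝ)) ∧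
    (∀ n, τ n ∈ s) ∧ Q = fun n => sampleLaw θ f n (τ n * p / √(n : ℝ))}

end Axial

end

/-!
The surface measure is invariant under linear isometries, so under the uniform law the squared
projection `v(x) = (x'θ)²` has mean `1 / p` and second moment `3 / (p (p + 2))`; the fourth moments
come from a rotation by `π / 4` (`integral_inner_sq_mul_inner_sq`) and from `(∑ x_i²)² = 1`. Beyond
this, the proof uses only that the observations have density proportional to `f (κ v)` with respect
to a probability measure, where `v` takes values in `[0, 1]`.

Let `L` be the likelihood ratio of a sample of size `n`, with `κ = O(n^(-1/2))`, let `D` be the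
normalized sum of the centred statistic `v` (`scoreSum`), and let
`M = exp (√n κ D - n κ² Var v / 2)` (`gaussLik`), which is also a product over the observations. The
ratio `h` of the two densities for one observation is `1 + O(κ²)` uniformly, and its mean is
`1 + o(κ²)` since the second-order term of `f` cancels against the normalizing integral
(`integral_ratio_sub_one_isLittleO`). Hence the first two moments of `L / M`, being the `n`-th powers
of those of `h`, tend to `1`, and `L / M → 1` in mean square (`tendsto_integral_sq_ratio_sub_one`).
On the logarithmic scale this is the expansion of the log-likelihood ratio.

The complex exponential moments of `D` converge to the Gaussian ones
(`tendsto_integral_cexp_scoreSum`). This gives the central limit theorem and bounds the second moment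
and the inverse moment of `M`, so that `L - M → 0` in `L¹`; in every asymptotic statement about the
alternatives `L` may therefore be replaced by `M`. Contiguity in both directions follows from the
moment bounds. Optimality of the one-sided tests is the Neyman-Pearson argument for the likelihood
ratio `M`, which is a monotone function of `D` (`eventually_power_le_of_threshold`). For
detectability, a test with rejection probability `α + η sin (ω D)` is used, since its level and power
are given by the complex exponential moments directly.
-/

noncomputable section

/-! ### Second-order expansions at zero -/

/-- Taylor's formula with Peano remainder, for a function that is only twice differentiable at the
point. -/
lemma isLittleO_sub_taylor_two {f f' : ℝ → ℝ} {b : ℝ} (hf : ∀ᶠ x in 𝓝 0, HasDerivAt f (f' x) x)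
    (hf' : HasDerivAt f' b 0) :
    (fun x => f x - (f 0 + f' 0 * x + b / 2 * x ^ 2)) =o[𝓝 0] (fun x : ℝ => x ^ 2) := by
  rw [isLittleO_iff]
  intro c hc
  have h1 := hf'.isLittleO
  rw [isLittleO_iff] at h1
  have h2 := (h1 hc).and hf
  rw [Metric.eventually_nhds_iff_ball] at h2
  obtain ⟨δ, hδ, h2⟩ := h2
  filter_upwards [Metric.ball_mem_nhds (0 : ℝ) hδ] with x hx
  -- The remainder has derivative `f' y - f' 0 - b y`, which is at most `c |x|` between `0` and `x`.
  have key := Convex.norm_image_sub_le_of_norm_hasDerivWithin_le (s := Set.uIcc 0 x)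
    (f := fun y => f y - (f 0 + f' 0 * y + b / 2 * y ^ 2))
    (f' := fun y => f' y - (f' 0 + b * y)) (x := 0) (y := x) (C := c * ‖x‖)
    ?_ ?_ (convex_uIcc 0 x) Set.left_mem_uIcc Set.right_mem_uIcc
  · simp only [mul_zero, add_zero, sub_self, sub_zero, ne_eq, OfNat.ofNat_ne_zero,
      not_false_eq_true, zero_pow] at key
    calc _ ≤ _ := key
      _ = c * ‖x ^ 2‖ := by rw [norm_pow]; ring
  · intro y hy
    have hyx : |y| ≤ |x| := by
      simpa using Set.abs_sub_left_of_mem_uIcc hy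
    have hyb : y ∈ Metric.ball (0 : ℝ) δ := by
      simp only [Metric.mem_ball, dist_zero_right, Real.norm_eq_abs] at hx ⊢
      linarith
    have h3 := (h2 y hyb).2
    refine HasDerivAt.hasDerivWithinAt ?_
    have h4 : HasDerivAt (fun y : ℝ => f 0 + f' 0 * y + b / 2 * y ^ 2) (f' 0 + b * y) y := by
      have := (((hasDerivAt_id y).const_mul (f' 0)).const_add (f 0)).add
        (((hasDerivAt_id y).pow 2).const_mul (b / 2))
      exact this.congr_deriv (by simp; ring)
    exact h3.sub h4
  · intro y hy
    have hyx : |y| ≤ |x| := by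
      simpa using Set.abs_sub_left_of_mem_uIcc hy
    have hyb : y ∈ Metric.ball (0 : ℝ) δ := by
      simp only [Metric.mem_ball, dist_zero_right, Real.norm_eq_abs] at hx ⊢
      linarith
    have h3 := (h2 y hyb).1
    simp only [sub_zero, smul_eq_mul] at h3
    calc ‖f' y - (f' 0 + b * y)‖ = ‖f' y - f' 0 - y * b‖ := by ring_nf
      _ ≤ c * ‖y‖ := h3
      _ ≤ c * ‖x‖ := by gcongr; exact hyx

/-- Multiplication of second-order expansions. -/
lemma isLittleO_mul_expansion {F G : ℝ → ℝ} {a b a' b' : ℝ}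
    (hF : (fun x => F x - (1 + a * x + b * x ^ 2)) =o[𝓝 0] (fun x : ℝ => x ^ 2))
    (hG : (fun x => G x - (1 + a' * x + b' * x ^ 2)) =o[𝓝 0] (fun x : ℝ => x ^ 2)) :
    (fun x => F x * G x - (1 + (a + a') * x + (b + b' + a * a') * x ^ 2))
      =o[𝓝 0] (fun x : ℝ => x ^ 2) := by
  have hsq : Tendsto (fun x : ℝ => x ^ 2) (𝓝 0) (𝓝 0) := by
    simpa using (continuous_pow 2).tendsto (0 : ℝ)
  have hP : Tendsto (fun x : ℝ => 1 + a * x + b * x ^ 2) (𝓝 0) (𝓝 1) := by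
    have : Continuous (fun x : ℝ => 1 + a * x + b * x ^ 2) := by fun_prop
    simpa using this.tendsto 0
  have hP' : Tendsto (fun x : ℝ => 1 + a' * x + b' * x ^ 2) (𝓝 0) (𝓝 1) := by
    have : Continuous (fun x : ℝ => 1 + a' * x + b' * x ^ 2) := by fun_prop
    simpa using this.tendsto 0
  have hGt : Tendsto G (𝓝 0) (𝓝 1) := by
    have := (hG.trans_tendsto hsq).add hP'
    simpa using this
  have h1 := hF.mul_isBigO (hGt.isBigO_one ℝ)
  have h2 := (hP.isBigO_one ℝ).mul_isLittleO hG
  have h3 : (fun x : ℝ => x ^ 2 * (x * (a * b' + b * a' + b * b' * x)))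
      =o[𝓝 0] (fun x : ℝ => x ^ 2 * 1) := by
    refine (isBigO_refl _ _).mul_isLittleO ?_
    rw [isLittleO_one_iff]
    have : Continuous (fun x : ℝ => x * (a * b' + b * a' + b * b' * x)) := by fun_prop
    simpa using this.tendsto 0
  simp only [mul_one, one_mul] at h1 h2 h3
  refine ((h1.add h2).add h3).congr_left fun x => ?_
  ring

lemma IsAngularFunction.exists_expansion {f : ℝ → ℝ} (hf : IsAngularFunction f) :
    ∃ b : ℝ, (fun x => f x - (1 + 1 * x + b * x ^ 2)) =o[𝓝 0] (fun x : ℝ => x ^ 2) := by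
  refine ⟨deriv (deriv f) 0 / 2, ?_⟩
  have := isLittleO_sub_taylor_two (f := f) (f' := deriv f)
    (hf.differentiableNear.mono fun x hx => hx.hasDerivAt) hf.twiceDifferentiableAt.hasDerivAt
  rwa [hf.map_zero, hf.deriv_zero] at this

lemma isLittleO_exp_expansion (m s : ℝ) :
    (fun x => Real.exp (m * x + s / 2 * x ^ 2) - (1 + m * x + (s + m ^ 2) / 2 * x ^ 2))
      =o[𝓝 0] (fun x : ℝ => x ^ 2) := by
  have hlin : ∀ x : ℝ, HasDerivAt (fun x : ℝ => m * x + s / 2 * x ^ 2) (m + s * x) x := fun x => by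
    have := ((hasDerivAt_id x).const_mul m).add (((hasDerivAt_id x).pow 2).const_mul (s / 2))
    exact this.congr_deriv (by simp; ring)
  have hexp := fun x => (hlin x).exp
  have h2 : HasDerivAt (fun x : ℝ => Real.exp (m * x + s / 2 * x ^ 2) * (m + s * x))
      (s + m ^ 2) 0 := by
    have := (hexp 0).mul (((hasDerivAt_id (0 : ℝ)).const_mul s).const_add m)
    exact this.congr_deriv (by simp; ring)
  simpa using isLittleO_sub_taylor_two (Eventually.of_forall hexp) h2

/-! ### A one-parameter family of densities built on a bounded statistic -/

section OneObservation

variable {X : Type*} [MeasurableSpace X]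

/-- The integral that normalizes the density `x ↦ f (κ v(x))` with respect to `μ`. -/
def angNorm (μ : Measure X) (v : X → ℝ) (f : ℝ → ℝ) (κ : ℝ) : ℝ := ∫ x, f (κ * v x) ∂μ

/-- The probability density proportional to `x ↦ f (κ v(x))` with respect to `μ`. -/
def angDens (μ : Measure X) (v : X → ℝ) (f : ℝ → ℝ) (κ : ℝ) (x : X) : ℝ :=
  f (κ * v x) / angNorm μ v f κ

/-- The factor `exp (κ (v - E v) - κ² Var v / 2)` that approximates the density of one observation.
It need not be a probability density, but its integral is `1 + o(κ²)`. -/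
def gaussFactor (μ : Measure X) (v : X → ℝ) (κ : ℝ) (x : X) : ℝ :=
  Real.exp (κ * (v x - ∫ y, v y ∂μ) - κ ^ 2 * Var[v; μ] / 2)

lemma gaussFactor_pos (μ : Measure X) (v : X → ℝ) (κ : ℝ) (x : X) :
    0 < gaussFactor μ v κ x := Real.exp_pos _

/-- The ratio of the density to its approximation is a constant times a function of `κ v(x)`. -/
lemma angDens_div_gaussFactor (μ : Measure X) (v : X → ℝ) (f : ℝ → ℝ) (κ : ℝ) (x : X) :
    angDens μ v f κ x / gaussFactor μ v κ x =
      Real.exp ((∫ x, v x ∂μ) * κ + Var[v; μ] / 2 * κ ^ 2) / angNorm μ v f κ *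
        (f (κ * v x) * Real.exp (-(κ * v x))) := by
  have : Real.exp ((∫ x, v x ∂μ) * κ + Var[v; μ] / 2 * κ ^ 2) * Real.exp (-(κ * v x)) =
      (gaussFactor μ v κ x)⁻¹ := by
    rw [gaussFactor, ← Real.exp_add, ← Real.exp_neg]
    ring_nf
  rw [angDens, div_eq_mul_inv, ← this]
  ring

variable {μ : Measure X} [IsProbabilityMeasure μ] {v : X → ℝ}

lemma integrable_of_abs_le {Y : Type*} [MeasurableSpace Y] {ν : Measure Y} [IsFiniteMeasure ν]
    {F : Y → ℝ} (hF : Measurable F) {C : ℝ} (hC : ∀ x, |F x| ≤ C) : Integrable F ν :=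
  Integrable.of_bound hF.aestronglyMeasurable C (Eventually.of_forall hC)

lemma abs_mul_le_of_mem_Icc {κ t : ℝ} (ht : t ∈ Set.Icc (0 : ℝ) 1) : |κ * t| ≤ |κ| := by
  rw [abs_mul, abs_of_nonneg ht.1]
  exact mul_le_of_le_one_right (abs_nonneg _) ht.2

/-- A property of real numbers that holds near `0` holds at `κ v(x)`, uniformly in `x`, as soon as
`κ` is small. -/
lemma eventually_forall_mul {X : Type*} {v : X → ℝ} (hv1 : ∀ x, v x ∈ Set.Icc (0 : ℝ) 1)
    {q : ℝ → Prop} (hq : ∀ᶠ x in 𝓝 (0 : ℝ), q x) : ∀ᶠ κ in 𝓝 (0 : ℝ), ∀ x, q (κ * v x) := by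
  rw [Metric.eventually_nhds_iff] at hq ⊢
  obtain ⟨δ, hδ, h⟩ := hq
  refine ⟨δ, hδ, fun κ hκ x => h ?_⟩
  rw [Real.dist_0_eq_abs] at hκ ⊢
  exact (abs_mul_le_of_mem_Icc (hv1 x)).trans_lt hκ

lemma variance_eq_of_mem_Icc (hv : Measurable v) (hv1 : ∀ x, v x ∈ Set.Icc (0 : ℝ) 1) :
    Var[v; μ] = ∫ x, v x ^ 2 ∂μ - (∫ x, v x ∂μ) ^ 2 := by
  have : MemLp v 2 μ := MemLp.of_bound hv.aestronglyMeasurable 1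
    (Eventually.of_forall fun x => by
      rw [Real.norm_eq_abs, abs_le]
      constructor <;> linarith [(hv1 x).1, (hv1 x).2])
  rw [variance_eq_sub this]
  rfl

/-- A second-order expansion of `F` at zero may be integrated along the scaled statistic `κ v`. -/
lemma integral_expansion (hv : Measurable v) (hv1 : ∀ x, v x ∈ Set.Icc (0 : ℝ) 1) {F : ℝ → ℝ}
    (hFm : Measurable F) {a b : ℝ}
    (hF : (fun x => F x - (1 + a * x + b * x ^ 2)) =o[𝓝 0] (fun x : ℝ => x ^ 2)) :
    (fun κ => ∫ x, F (κ * v x) ∂μ - (1 + (a * ∫ x, v x ∂μ) * κ + (b * ∫ x, v x ^ 2 ∂μ) * κ ^ 2))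
      =o[𝓝 0] (fun κ : ℝ => κ ^ 2) := by
  have hi1 : Integrable v μ := integrable_of_abs_le hv (C := 1) fun x => by
    rw [abs_le]; constructor <;> linarith [(hv1 x).1, (hv1 x).2]
  have hi2 : Integrable (fun x => v x ^ 2) μ := integrable_of_abs_le (hv.pow_const 2) (C := 1)
    fun x => by
      rw [abs_pow]
      exact pow_le_one₀ (abs_nonneg _) (abs_le.2 ⟨by linarith [(hv1 x).1], (hv1 x).2⟩)
  rw [isLittleO_iff] at hF ⊢
  intro c hc
  filter_upwards [eventually_forall_mul hv1 (hF hc)] with κ hκ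
  have hb : ∀ x, |F (κ * v x) - (1 + a * (κ * v x) + b * (κ * v x) ^ 2)| ≤ c * ‖κ ^ 2‖ := by
    intro x
    refine (hκ x).trans ?_
    gcongr c * ?_
    rw [norm_pow, norm_pow]
    gcongr
    exact abs_mul_le_of_mem_Icc (hv1 x)
  have hR : Integrable (fun x => F (κ * v x) - (1 + a * (κ * v x) + b * (κ * v x) ^ 2)) μ :=
    integrable_of_abs_le (by fun_prop) hb
  have e : (∫ x, F (κ * v x) ∂μ) -
      (1 + (a * ∫ x, v x ∂μ) * κ + (b * ∫ x, v x ^ 2 ∂μ) * κ ^ 2)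
      = ∫ x, (F (κ * v x) - (1 + a * (κ * v x) + b * (κ * v x) ^ 2)) ∂μ := by
    have hp : Integrable (fun x => 1 + a * κ * v x + b * κ ^ 2 * v x ^ 2) μ :=
      ((integrable_const 1).add (hi1.const_mul _)).add (hi2.const_mul _)
    have e1 : (∫ x, (1 + a * κ * v x + b * κ ^ 2 * v x ^ 2) ∂μ) =
        1 + (a * ∫ x, v x ∂μ) * κ + (b * ∫ x, v x ^ 2 ∂μ) * κ ^ 2 := by
      rw [integral_add (f := fun x => 1 + a * κ * v x)
        ((integrable_const 1).add (hi1.const_mul _)) (hi2.const_mul _),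
        integral_add (integrable_const 1) (hi1.const_mul _), integral_const_mul,
        integral_const_mul]
      simp
      ring
    have e2 : ∀ x, F (κ * v x) = (F (κ * v x) - (1 + a * (κ * v x) + b * (κ * v x) ^ 2)) +
      (1 + a * κ * v x + b * κ ^ 2 * v x ^ 2) := fun x => by ring
    rw [← e1, integral_congr_ae (Eventually.of_forall e2), integral_add hR hp]
    ring
  rw [e]
  refine (norm_integral_le_of_norm_le_const (Eventually.of_forall hb)).trans ?_
  simp

lemma isLittleO_tendsto_one {F : ℝ → ℝ} {a b : ℝ}
    (hF : (fun x => F x - (1 + a * x + b * x ^ 2)) =o[𝓝 0] (fun x : ℝ => x ^ 2)) :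
    Tendsto F (𝓝 0) (𝓝 1) := by
  have hsq : Tendsto (fun x : ℝ => x ^ 2) (𝓝 0) (𝓝 0) := by
    simpa using (continuous_pow 2).tendsto (0 : ℝ)
  have hP : Tendsto (fun x : ℝ => 1 + a * x + b * x ^ 2) (𝓝 0) (𝓝 1) := by
    have : Continuous (fun x : ℝ => 1 + a * x + b * x ^ 2) := by fun_prop
    simpa using this.tendsto 0
  simpa using (hF.trans_tendsto hsq).add hP

lemma exp_neg_expansion : (fun x : ℝ => Real.exp (-x) - (1 + (-1) * x + (1 / 2) * x ^ 2))
    =o[𝓝 0] (fun x : ℝ => x ^ 2) := by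
  simpa using isLittleO_exp_expansion (-1) 0

/-- The ratio of the density of one observation to its approximation has mean `1 + o(κ²)`: the
second-order coefficient of `f` cancels. -/
lemma integral_ratio_sub_one_isLittleO (hv : Measurable v) (hv1 : ∀ x, v x ∈ Set.Icc (0 : ℝ) 1)
    {f : ℝ → ℝ} (hf : IsAngularFunction f) :
    (fun κ => ∫ x, angDens μ v f κ x / gaussFactor μ v κ x ∂μ - 1)
      =o[𝓝 0] (fun κ : ℝ => κ ^ 2) := by
  obtain ⟨b, hb⟩ := hf.exists_expansion
  have hfm : Measurable f := hf.monotone.measurable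
  have hA := integral_expansion (μ := μ) hv hv1 hfm hb
  have hB := integral_expansion (μ := μ) hv hv1 (hfm.mul (by fun_prop))
    (isLittleO_mul_expansion hb exp_neg_expansion)
  have hc := isLittleO_exp_expansion (∫ x, v x ∂μ) Var[v; μ]
  have hcB := isLittleO_mul_expansion hc hB
  have hA1 : Tendsto (angNorm μ v f) (𝓝 0) (𝓝 1) := isLittleO_tendsto_one hA
  have hd := hcB.sub hA
  have hd2 := hd.mul_isBigO ((hA1.inv₀ one_ne_zero).isBigO_one ℝ)
  have hne : ∀ᶠ κ in 𝓝 (0 : ℝ), angNorm μ v f κ ≠ 0 := hA1.eventually_ne one_ne_zero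
  simp only [mul_one] at hd2
  refine hd2.congr' ?_ EventuallyEq.rfl
  filter_upwards [hne] with κ hκ
  simp_rw [angDens_div_gaussFactor]
  rw [integral_const_mul]
  rw [variance_eq_of_mem_Icc hv hv1] at *
  simp only [Pi.mul_apply]
  have : angNorm μ v f κ = ∫ x, f (κ * v x) ∂μ := rfl
  rw [← this]
  field_simp
  ring

/-- The ratio of the density of one observation to its approximation is `1 + O(κ²)`, uniformly on
the sample space. -/
lemma exists_abs_ratio_sub_one_le (hv : Measurable v) (hv1 : ∀ x, v x ∈ Set.Icc (0 : ℝ) 1)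
    {f : ℝ → ℝ} (hf : IsAngularFunction f) :
    ∃ C : ℝ, 0 < C ∧ ∀ᶠ κ in 𝓝 (0 : ℝ), ∀ x,
      |angDens μ v f κ x / gaussFactor μ v κ x - 1| ≤ C * κ ^ 2 := by
  obtain ⟨b, hb⟩ := hf.exists_expansion
  have hfm : Measurable f := hf.monotone.measurable
  have hA := integral_expansion (μ := μ) hv hv1 hfm hb
  have hF := isLittleO_mul_expansion hb exp_neg_expansion
  have hc := isLittleO_exp_expansion (∫ x, v x ∂μ) Var[v; μ]
  have hA1 : Tendsto (angNorm μ v f) (𝓝 0) (𝓝 1) := isLittleO_tendsto_one hA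
  have hd := (hc.sub hA).isBigO.add (isBigO_const_mul_self
    ((Var[v; μ] + (∫ x, v x ∂μ) ^ 2) / 2 - b * ∫ x, v x ^ 2 ∂μ) (fun κ : ℝ => κ ^ 2) (𝓝 0))
  have hd2 := hd.mul ((hA1.inv₀ one_ne_zero).isBigO_one ℝ)
  obtain ⟨C₁, hC₁, h1⟩ := hd2.exists_pos
  have hF2 := hF.isBigO.add (isBigO_const_mul_self
    (b + 1 / 2 + 1 * (-1)) (fun κ : ℝ => κ ^ 2) (𝓝 0))
  obtain ⟨C₂, hC₂, h2⟩ := hF2.exists_pos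
  have hF1 := isLittleO_tendsto_one hF
  have hne : ∀ᶠ κ in 𝓝 (0 : ℝ), angNorm μ v f κ ≠ 0 := hA1.eventually_ne one_ne_zero
  have hF3 : ∀ᶠ x in 𝓝 (0 : ℝ), |f x * Real.exp (-x)| ≤ 2 := by
    have := hF1.abs.eventually_lt_const (show |(1 : ℝ)| < 2 by norm_num)
    exact this.mono fun x hx => hx.le
  refine ⟨2 * C₁ + C₂, by positivity, ?_⟩
  filter_upwards [hne, h1.bound, eventually_forall_mul hv1 h2.bound,
    eventually_forall_mul hv1 hF3] with κ hκ k1 k2 k3 x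
  have k2 := k2 x
  have k3 := k3 x
  rw [angDens_div_gaussFactor]
  set F := f (κ * v x) * Real.exp (-(κ * v x)) with hFdef
  set r := Real.exp ((∫ x, v x ∂μ) * κ + Var[v; μ] / 2 * κ ^ 2) / angNorm μ v f κ with hr
  have e1 : |r - 1| ≤ C₁ * κ ^ 2 := by
    have : angNorm μ v f κ = ∫ x, f (κ * v x) ∂μ := rfl
    rw [← this] at k1
    simp only [mul_one, Real.norm_eq_abs, abs_pow, sq_abs] at k1
    refine le_of_eq_of_le ?_ k1
    congr 1
    rw [hr]
    field_simp
    ring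
  have e2 : |F - 1| ≤ C₂ * κ ^ 2 := by
    have k4 : |F - 1| ≤ C₂ * |κ * v x| ^ 2 := by
      simp only [Real.norm_eq_abs, abs_pow] at k2
      refine le_of_eq_of_le ?_ k2
      congr 1
      rw [hFdef]
      ring
    refine k4.trans ?_
    rw [← sq_abs κ]
    exact mul_le_mul_of_nonneg_left
      (pow_le_pow_left₀ (abs_nonneg _) (abs_mul_le_of_mem_Icc (hv1 x)) 2) hC₂.le
  calc |r * F - 1| = |(r - 1) * F + (F - 1)| := by ring_nf
    _ ≤ |r - 1| * |F| + |F - 1| := by rw [← abs_mul]; exact abs_add_le _ _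
    _ ≤ C₁ * κ ^ 2 * 2 + C₂ * κ ^ 2 := by gcongr
    _ = (2 * C₁ + C₂) * κ ^ 2 := by ring

end OneObservation

/-! ### Samples: the exact and the limiting likelihood ratio -/

section Samples

variable {X : Type} [MeasurableSpace X]

/-- The normalized sum `n^(-1/2) ∑ i, (v (x i) - E v)`. -/
def scoreSum (μ : Measure X) (v : X → ℝ) (n : ℕ) (x : Fin n → X) : ℝ :=
  (√(n : ℝ))⁻¹ * ∑ i, (v (x i) - ∫ y, v y ∂μ)

/-- The likelihood ratio of a sample of size `n`. -/
def likRatio (μ : Measure X) (v : X → ℝ) (f : ℝ → ℝ) (κ : ℝ) (n : ℕ) (x : Fin n → X) : ℝ :=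
  ∏ i, angDens μ v f κ (x i)

/-- The limiting form of the likelihood ratio of a sample of size `n`, as a product over the
observations; `gaussLik_eq_exp` expresses it through the normalized sum. -/
def gaussLik (μ : Measure X) (v : X → ℝ) (κ : ℝ) (n : ℕ) (x : Fin n → X) : ℝ :=
  ∏ i, gaussFactor μ v κ (x i)

/-- The law of a sample of size `n` with the given likelihood ratio. -/
def angSampleLaw (μ : Measure X) (v : X → ℝ) (f : ℝ → ℝ) (κ : ℝ) (n : ℕ) :
    Measure (Fin n → X) :=
  (Measure.pi fun _ => μ).withDensity fun x => ENNReal.ofReal (likRatio μ v f κ n x)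

lemma gaussLik_eq_exp (μ : Measure X) (v : X → ℝ) (κ : ℝ) (n : ℕ) (x : Fin n → X) :
    gaussLik μ v κ n x =
      Real.exp (√n * κ * scoreSum μ v n x - (√n * κ) ^ 2 * Var[v; μ] / 2) := by
  rw [gaussLik]
  simp only [gaussFactor]
  rw [← Real.exp_sum, Finset.sum_sub_distrib, ← Finset.mul_sum, mul_pow,
    Real.sq_sqrt (Nat.cast_nonneg n), scoreSum]
  congr 2
  · rcases Nat.eq_zero_or_pos n with rfl | hn
    · simp
    · have : √(n : ℝ) ≠ 0 := by positivity
      field_simp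
  · simp
    ring

lemma gaussLik_pos (μ : Measure X) (v : X → ℝ) (κ : ℝ) (n : ℕ) (x : Fin n → X) :
    0 < gaussLik μ v κ n x := Finset.prod_pos fun _ _ => gaussFactor_pos μ v κ _

lemma gaussLik_sq_le (μ : Measure X) (v : X → ℝ) (κ : ℝ) (n : ℕ) (x : Fin n → X) :
    gaussLik μ v κ n x ^ 2 ≤ Real.exp (2 * (√n * κ) * scoreSum μ v n x) := by
  rw [gaussLik_eq_exp, ← Real.exp_nat_mul, Real.exp_le_exp]
  have := mul_nonneg (sq_nonneg (√n * κ)) (variance_nonneg v μ)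
  push_cast
  linarith

lemma inv_gaussLik_eq (μ : Measure X) (v : X → ℝ) (κ : ℝ) (n : ℕ) (x : Fin n → X) :
    (gaussLik μ v κ n x)⁻¹ = Real.exp ((√n * κ) ^ 2 * Var[v; μ] / 2) *
      Real.exp (-(√n * κ) * scoreSum μ v n x) := by
  rw [gaussLik_eq_exp, ← Real.exp_neg, ← Real.exp_add]
  ring_nf

lemma measurable_scoreSum {μ : Measure X} {v : X → ℝ} (hv : Measurable v) (n : ℕ) :
    Measurable (scoreSum μ v n) := by
  unfold scoreSum
  fun_prop

lemma measurable_angDens {μ : Measure X} {v : X → ℝ} (hv : Measurable v) {f : ℝ → ℝ}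
    (hf : IsAngularFunction f) (κ : ℝ) : Measurable (angDens μ v f κ) :=
  (hf.monotone.measurable.comp (hv.const_mul κ)).div_const _

lemma measurable_gaussFactor {μ : Measure X} {v : X → ℝ} (hv : Measurable v) (κ : ℝ) :
    Measurable (gaussFactor μ v κ) := by
  unfold gaussFactor
  fun_prop

lemma measurable_likRatio {μ : Measure X} {v : X → ℝ} (hv : Measurable v) {f : ℝ → ℝ}
    (hf : IsAngularFunction f) (κ : ℝ) (n : ℕ) : Measurable (likRatio μ v f κ n) :=
  Finset.measurable_fun_prod _ fun i _ => (measurable_angDens hv hf κ).comp (measurable_pi_apply i)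

lemma measurable_gaussLik {μ : Measure X} {v : X → ℝ} (hv : Measurable v) (κ : ℝ) (n : ℕ) :
    Measurable (gaussLik μ v κ n) :=
  Finset.measurable_fun_prod _ fun i _ => (measurable_gaussFactor hv κ).comp (measurable_pi_apply i)

lemma angNorm_nonneg (μ : Measure X) (v : X → ℝ) {f : ℝ → ℝ} (hf : IsAngularFunction f) (κ : ℝ) :
    0 ≤ angNorm μ v f κ := integral_nonneg fun _ => hf.nonneg _

lemma angDens_nonneg (μ : Measure X) (v : X → ℝ) {f : ℝ → ℝ} (hf : IsAngularFunction f) (κ : ℝ)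
    (x : X) : 0 ≤ angDens μ v f κ x := div_nonneg (hf.nonneg _) (angNorm_nonneg μ v hf κ)

lemma likRatio_nonneg (μ : Measure X) (v : X → ℝ) {f : ℝ → ℝ} (hf : IsAngularFunction f) (κ : ℝ)
    (n : ℕ) (x : Fin n → X) : 0 ≤ likRatio μ v f κ n x :=
  Finset.prod_nonneg fun _ _ => angDens_nonneg μ v hf κ _

lemma likRatio_div_gaussLik (μ : Measure X) (v : X → ℝ) (f : ℝ → ℝ) (κ : ℝ)
    (n : ℕ) (x : Fin n → X) : likRatio μ v f κ n x / gaussLik μ v κ n x =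
      ∏ i, angDens μ v f κ (x i) / gaussFactor μ v κ (x i) := by
  rw [likRatio, gaussLik, Finset.prod_div_distrib]

variable {μ : Measure X} [IsProbabilityMeasure μ] {v : X → ℝ}

/-! ### Exponential moments and the central limit theorem -/

lemma abs_sub_integral_le_one (hv : Measurable v) (hv1 : ∀ x, v x ∈ Set.Icc (0 : ℝ) 1) (x : X) :
    |v x - ∫ y, v y ∂μ| ≤ 1 := by
  have h0 : 0 ≤ ∫ y, v y ∂μ := integral_nonneg fun y => (hv1 y).1
  have h1 : ∫ y, v y ∂μ ≤ 1 := by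
    have hi : Integrable v μ := integrable_of_abs_le hv (C := 1) fun x => by
      rw [abs_le]; constructor <;> linarith [(hv1 x).1, (hv1 x).2]
    calc ∫ y, v y ∂μ ≤ ∫ _, (1 : ℝ) ∂μ := integral_mono hi (integrable_const _) fun y => (hv1 y).2
      _ = 1 := by simp
  rw [abs_le]
  constructor <;> linarith [(hv1 x).1, (hv1 x).2]

lemma norm_integral_cexp_sub_le (hv : Measurable v) (hv1 : ∀ x, v x ∈ Set.Icc (0 : ℝ) 1) (ζ : ℂ) :
    ‖∫ x, Complex.exp (ζ * (v x - ∫ y, v y ∂μ : ℝ)) ∂μ - (1 + ζ ^ 2 * Var[v; μ] / 2)‖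
      ≤ ‖ζ‖ ^ 3 * Real.exp ‖ζ‖ := by
  set w : X → ℝ := fun x => v x - ∫ y, v y ∂μ with hw
  have hwm : Measurable w := by fun_prop
  have hw1 : ∀ x, |w x| ≤ 1 := abs_sub_integral_le_one hv hv1
  have hvi : Integrable v μ := integrable_of_abs_le hv (C := 1) fun x => by
    rw [abs_le]; constructor <;> linarith [(hv1 x).1, (hv1 x).2]
  have hi1 : Integrable w μ := integrable_of_abs_le hwm hw1
  have hi2 : Integrable (fun x => w x ^ 2) μ := integrable_of_abs_le (C := 1) (by fun_prop)
    fun x => by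
      rw [abs_pow]
      exact pow_le_one₀ (abs_nonneg _) (hw1 x)
  have hic1 : Integrable (fun x => (w x : ℂ)) μ := hi1.ofReal
  have hic2 : Integrable (fun x => ((w x ^ 2 : ℝ) : ℂ)) μ := hi2.ofReal
  have e1 : ∫ x, (w x : ℂ) ∂μ = 0 := by
    rw [integral_complex_ofReal, hw, integral_sub hvi (integrable_const _)]
    simp
  have e2 : ∫ x, ((w x ^ 2 : ℝ) : ℂ) ∂μ = Var[v; μ] := by
    rw [integral_complex_ofReal, variance_eq_integral hv.aemeasurable]
  have hb : ∀ x, ‖Complex.exp (ζ * w x) - (1 + ζ * w x + ζ ^ 2 / 2 * (w x ^ 2 : ℝ))‖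
      ≤ ‖ζ‖ ^ 3 * Real.exp ‖ζ‖ := fun x => by
    have h := Complex.norm_exp_sub_sum_le_norm_mul_exp (ζ * w x) 3
    have hz : ‖ζ * w x‖ ≤ ‖ζ‖ := by
      rw [norm_mul, Complex.norm_real]
      exact mul_le_of_le_one_right (norm_nonneg _) (hw1 x)
    have e : ∑ m ∈ Finset.range 3, (ζ * w x) ^ m / (m.factorial : ℂ) =
        1 + ζ * w x + ζ ^ 2 / 2 * (w x ^ 2 : ℝ) := by
      simp [Finset.sum_range_succ, Nat.factorial]
      ring
    rw [e] at h
    refine h.trans ?_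
    gcongr
  have hexpi : Integrable (fun x => Complex.exp (ζ * w x)) μ := by
    refine Integrable.of_bound (C := Real.exp ‖ζ‖) (by fun_prop) (Eventually.of_forall fun x => ?_)
    rw [Complex.norm_exp, Real.exp_le_exp]
    refine (Complex.re_le_norm _).trans ?_
    rw [norm_mul, Complex.norm_real]
    exact mul_le_of_le_one_right (norm_nonneg _) (hw1 x)
  have hp1 : Integrable (fun x => 1 + ζ * (w x : ℂ)) μ :=
    (integrable_const 1).add (hic1.const_mul _)
  have hp : Integrable (fun x => 1 + ζ * (w x : ℂ) + ζ ^ 2 / 2 * (w x ^ 2 : ℝ)) μ :=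
    hp1.add (hic2.const_mul _)
  have e3 : ∫ x, (1 + ζ * (w x : ℂ) + ζ ^ 2 / 2 * (w x ^ 2 : ℝ)) ∂μ
      = 1 + ζ ^ 2 * Var[v; μ] / 2 := by
    rw [integral_add hp1 (hic2.const_mul _), integral_add (integrable_const 1) (hic1.const_mul _),
      integral_const_mul, integral_const_mul, e1, e2]
    simp
    ring
  rw [← e3, ← integral_sub hexpi hp]
  refine (norm_integral_le_of_norm_le_const (Eventually.of_forall hb)).trans ?_
  simp

/-- All complex exponential moments of the normalized sum converge to those of the Gaussian law.
On the imaginary axis this is the central limit theorem, on the real axis it bounds the moments of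
the limiting likelihood ratio, and elsewhere it gives the law of the sum under the local
alternatives. -/
lemma tendsto_integral_cexp_scoreSum (hv : Measurable v) (hv1 : ∀ x, v x ∈ Set.Icc (0 : ℝ) 1)
    (z : ℂ) : Tendsto (fun n : ℕ => ∫ x, Complex.exp (z * scoreSum μ v n x)
      ∂(Measure.pi fun _ : Fin n => μ)) atTop (𝓝 (Complex.exp (z ^ 2 * Var[v; μ] / 2))) := by
  have hprod : ∀ n : ℕ, ∫ x, Complex.exp (z * scoreSum μ v n x) ∂(Measure.pi fun _ : Fin n => μ) =
      (1 + (∫ x, Complex.exp (z * (√n : ℝ)⁻¹ * (v x - ∫ y, v y ∂μ : ℝ)) ∂μ - 1)) ^ n := by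
    intro n
    have : ∀ x : Fin n → X, Complex.exp (z * scoreSum μ v n x) =
        ∏ i, Complex.exp (z * (√n : ℝ)⁻¹ * (v (x i) - ∫ y, v y ∂μ : ℝ)) := fun x => by
      rw [← Complex.exp_sum, scoreSum, ← Finset.mul_sum]
      simp only [Complex.ofReal_mul, Complex.ofReal_sum]
      rw [mul_assoc]
    simp_rw [this]
    rw [integral_fintype_prod_eq_pow
      (fun x => Complex.exp (z * (√n : ℝ)⁻¹ * (v x - ∫ y, v y ∂μ : ℝ))), Fintype.card_fin]
    ring
  simp_rw [hprod]
  refine Complex.tendsto_one_add_pow_exp_of_tendsto ?_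
  rw [tendsto_iff_norm_sub_tendsto_zero]
  have hlim : Tendsto (fun n : ℕ => (√(n : ℝ))⁻¹ * (‖z‖ ^ 3 * Real.exp ‖z‖)) atTop (𝓝 0) := by
    have : Tendsto (fun n : ℕ => (√(n : ℝ))⁻¹) atTop (𝓝 0) :=
      (Real.tendsto_sqrt_atTop.comp tendsto_natCast_atTop_atTop).inv_tendsto_atTop
    simpa using this.mul_const _
  refine squeeze_zero' (Eventually.of_forall fun _ => norm_nonneg _) ?_ hlim
  filter_upwards [eventually_ge_atTop 1] with n hn
  have hn' : (1 : ℝ) ≤ √n := by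
    rw [Real.one_le_sqrt]
    exact_mod_cast hn
  have hs : √(n : ℝ) * √n = n := Real.mul_self_sqrt (Nat.cast_nonneg n)
  have hb := norm_integral_cexp_sub_le (μ := μ) hv hv1 (z * (√n : ℝ)⁻¹)
  have hnorm : ‖z * (((√n : ℝ)⁻¹ : ℝ) : ℂ)‖ = ‖z‖ * (√n)⁻¹ := by
    rw [norm_mul, Complex.norm_real, Real.norm_of_nonneg (by positivity)]
  rw [hnorm] at hb
  have hle : ‖z‖ * (√(n : ℝ))⁻¹ ≤ ‖z‖ :=
    mul_le_of_le_one_right (norm_nonneg _) (inv_le_one_of_one_le₀ hn')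
  set E := ∫ x, Complex.exp (z * (√n : ℝ)⁻¹ * (v x - ∫ y, v y ∂μ : ℝ)) ∂μ
  have hne : √(n : ℝ) ≠ 0 := by positivity
  have key : (n : ℂ) * (E - 1) - z ^ 2 * Var[v; μ] / 2 =
      n * (E - (1 + (z * (√n : ℝ)⁻¹) ^ 2 * Var[v; μ] / 2)) := by
    have h2 : (n : ℂ) * (((√n : ℝ)⁻¹ : ℝ) : ℂ) ^ 2 = 1 := by
      have h3 : (n : ℝ) * ((√n : ℝ)⁻¹) ^ 2 = 1 := by
        nth_rewrite 1 [← hs]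
        field_simp
      exact_mod_cast h3
    linear_combination (z ^ 2 * Var[v; μ] / 2) * h2
  rw [key, norm_mul, Complex.norm_natCast]
  calc (n : ℝ) * ‖E - (1 + (z * (√n : ℝ)⁻¹) ^ 2 * Var[v; μ] / 2)‖
      ≤ n * ((‖z‖ * (√n)⁻¹) ^ 3 * Real.exp (‖z‖ * (√n)⁻¹)) := by gcongr
    _ ≤ n * ((‖z‖ * (√n)⁻¹) ^ 3 * Real.exp ‖z‖) := by gcongr
    _ = (√(n : ℝ))⁻¹ * (‖z‖ ^ 3 * Real.exp ‖z‖) := by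
      nth_rewrite 1 [← hs]
      field_simp

lemma tendsto_integral_exp_scoreSum (hv : Measurable v) (hv1 : ∀ x, v x ∈ Set.Icc (0 : ℝ) 1)
    (t : ℝ) : Tendsto (fun n : ℕ => ∫ x, Real.exp (t * scoreSum μ v n x)
      ∂(Measure.pi fun _ : Fin n => μ)) atTop (𝓝 (Real.exp (t ^ 2 * Var[v; μ] / 2))) := by
  have h := (Complex.continuous_re.tendsto _).comp
    (tendsto_integral_cexp_scoreSum (μ := μ) hv hv1 t)
  have e : (Complex.exp ((t : ℂ) ^ 2 * Var[v; μ] / 2)).re = Real.exp (t ^ 2 * Var[v; μ] / 2) := by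
    rw [← Complex.ofReal_re (Real.exp _)]
    push_cast
    rfl
  rw [e] at h
  refine h.congr fun n => ?_
  simp only [Function.comp]
  rw [← Complex.ofReal_re (∫ x, Real.exp (t * scoreSum μ v n x) ∂_), ← integral_complex_ofReal]
  push_cast
  rfl

/-- The central limit theorem for the normalized sum. -/
lemma isAsymptoticallyNormal_const_mul_scoreSum (hv : Measurable v)
    (hv1 : ∀ x, v x ∈ Set.Icc (0 : ℝ) 1) (a : ℝ) :
    IsAsymptoticallyNormal (fun n => Measure.pi fun _ : Fin n => μ)
      (fun n x => a * scoreSum μ v n x) (a ^ 2 * Var[v; μ]) := by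
  have hV : 0 ≤ a ^ 2 * Var[v; μ] := mul_nonneg (sq_nonneg a) (variance_nonneg v μ)
  have hm : ∀ n, Measurable (fun x => a * scoreSum μ v n x) := fun n =>
    (measurable_scoreSum hv n).const_mul a
  refine ⟨hV, inferInstance, fun n => (hm n).aemeasurable, aemeasurable_id, ?_⟩
  refine ProbabilityMeasure.tendsto_iff_tendsto_charFun.2 fun t => ?_
  have h := tendsto_integral_cexp_scoreSum (μ := μ) hv hv1 (t * a * Complex.I)
  simp only [ProbabilityMeasure.coe_mk, Measure.map_id, charFun_gaussianReal]
  have e : Complex.exp ((t * a * Complex.I) ^ 2 * Var[v; μ] / 2) =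
      Complex.exp (t * (0 : ℝ) * Complex.I - ((a ^ 2 * Var[v; μ]).toNNReal : ℝ) * t ^ 2 / 2) := by
    rw [Real.coe_toNNReal _ hV, mul_pow, Complex.I_sq]
    push_cast
    ring_nf
  rw [e] at h
  refine h.congr fun n => ?_
  rw [charFun_apply_real, integral_map (hm n).aemeasurable (by fun_prop)]
  refine integral_congr_ae (Eventually.of_forall fun x => ?_)
  simp only
  push_cast
  ring_nf

end Samples

/-! ### Approximation of the likelihood ratio by its limiting form -/

section Approximation

lemma tendsto_inv_sqrt_natCast : Tendsto (fun n : ℕ => 1 / √(n : ℝ)) atTop (𝓝 0) := by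
  simp_rw [one_div]
  exact (Real.tendsto_sqrt_atTop.comp tendsto_natCast_atTop_atTop).inv_tendsto_atTop

lemma exists_abs_sqrt_mul_le {κ : ℕ → ℝ} (hκ : κ =O[atTop] (fun n : ℕ => 1 / √(n : ℝ))) :
    ∃ T : ℝ, 0 < T ∧ ∀ᶠ n : ℕ in atTop, |√n * κ n| ≤ T := by
  obtain ⟨T, hT, h⟩ := hκ.exists_pos
  refine ⟨T, hT, ?_⟩
  filter_upwards [h.bound, eventually_ge_atTop 1] with n hn hn1
  have h0 : 0 < √(n : ℝ) := Real.sqrt_pos.2 (by exact_mod_cast hn1)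
  rw [abs_mul, abs_of_pos h0]
  rw [Real.norm_eq_abs, Real.norm_of_nonneg (by positivity)] at hn
  calc √n * |κ n| ≤ √n * (T * (1 / √n)) := by gcongr
    _ = T := by field_simp

lemma tendsto_zero_of_forall_le_add {u : ℕ → ℝ} (hu : ∀ n, 0 ≤ u n) (C : ℝ)
    (w : ℝ → ℕ → ℝ) (hw : ∀ δ, 0 < δ → Tendsto (w δ) atTop (𝓝 0))
    (h : ∀ δ, 0 < δ → ∀ᶠ n in atTop, u n ≤ δ * C + w δ n) : Tendsto u atTop (𝓝 0) := by
  rw [Metric.tendsto_nhds]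
  intro ε hε
  set δ := ε / (2 * (|C| + 1)) with hδ
  have hδ0 : 0 < δ := by positivity
  have h1 : δ * C ≤ ε / 2 := by
    calc δ * C ≤ δ * (|C| + 1) := by gcongr; linarith [le_abs_self C]
      _ = ε / 2 := by rw [hδ]; field_simp
  filter_upwards [h δ hδ0, (hw δ hδ0).eventually_lt_const (half_pos hε)] with n a1 a2
  rw [Real.dist_0_eq_abs, abs_of_nonneg (hu n)]
  linarith

variable {X : Type} [MeasurableSpace X]

lemma abs_angDens_le {μ : Measure X} {v : X → ℝ} (hv1 : ∀ x, v x ∈ Set.Icc (0 : ℝ) 1)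
    {f : ℝ → ℝ} (hf : IsAngularFunction f) (κ : ℝ) (x : X) :
    |angDens μ v f κ x| ≤ f |κ| / angNorm μ v f κ := by
  rw [abs_of_nonneg (angDens_nonneg μ v hf κ x), angDens]
  have := angNorm_nonneg μ v hf κ
  gcongr
  exact hf.monotone ((le_abs_self _).trans (abs_mul_le_of_mem_Icc (hv1 x)))

lemma integral_sub_two_mul_add_one {Y : Type*} [MeasurableSpace Y] {ν : Measure Y}
    [IsProbabilityMeasure ν] {F G : Y → ℝ} (hF : Integrable F ν) (hG : Integrable G ν) :
    ∫ y, (G y - 2 * F y + 1) ∂ν = ∫ y, G y ∂ν - 2 * ∫ y, F y ∂ν + 1 := by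
  rw [integral_add (f := fun y => G y - 2 * F y) (hG.sub (hF.const_mul 2)) (integrable_const 1),
    integral_sub hG (hF.const_mul 2), integral_const_mul]
  simp

variable {μ : Measure X} [IsProbabilityMeasure μ] {v : X → ℝ}

lemma integrable_prod_of_abs_le {F : X → ℝ} (hF : Measurable F) {C : ℝ} (hC : ∀ x, |F x| ≤ C)
    (n : ℕ) : Integrable (fun x : Fin n → X => ∏ i, F (x i)) (Measure.pi fun _ => μ) :=
  Integrable.fintype_prod fun _ => integrable_of_abs_le hF hC

lemma integrable_likRatio (hv : Measurable v) (hv1 : ∀ x, v x ∈ Set.Icc (0 : ℝ) 1) {f : ℝ → ℝ}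
    (hf : IsAngularFunction f) (κ : ℝ) (n : ℕ) :
    Integrable (likRatio μ v f κ n) (Measure.pi fun _ => μ) :=
  integrable_prod_of_abs_le (measurable_angDens hv hf κ) (abs_angDens_le hv1 hf κ) n

lemma exists_abs_scoreSum_le (hv : Measurable v) (hv1 : ∀ x, v x ∈ Set.Icc (0 : ℝ) 1) (n : ℕ) :
    ∃ C, ∀ x, |scoreSum μ v n x| ≤ C := by
  refine ⟨(√n)⁻¹ * n, fun x => ?_⟩
  rw [scoreSum, abs_mul, abs_of_nonneg (by positivity)]
  gcongr
  refine (Finset.abs_sum_le_sum_abs _ _).trans ?_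
  calc ∑ i, |v (x i) - ∫ y, v y ∂μ| ≤ ∑ _i : Fin n, (1 : ℝ) :=
        Finset.sum_le_sum fun i _ => abs_sub_integral_le_one hv hv1 _
    _ = n := by simp

lemma integrable_exp_scoreSum (hv : Measurable v) (hv1 : ∀ x, v x ∈ Set.Icc (0 : ℝ) 1) (n : ℕ)
    (t : ℝ) : Integrable (fun x => Real.exp (t * scoreSum μ v n x))
      (Measure.pi fun _ : Fin n => μ) := by
  obtain ⟨C, hC⟩ := exists_abs_scoreSum_le (μ := μ) hv hv1 n
  refine integrable_of_abs_le (C := Real.exp (|t| * C))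
    (((measurable_scoreSum hv n).const_mul t).exp) fun x => ?_
  rw [Real.abs_exp, Real.exp_le_exp]
  refine (le_abs_self _).trans ?_
  rw [abs_mul]
  gcongr
  exact hC x

lemma integrable_gaussLik_sq (hv : Measurable v) (hv1 : ∀ x, v x ∈ Set.Icc (0 : ℝ) 1) (κ : ℝ)
    (n : ℕ) : Integrable (fun x => gaussLik μ v κ n x ^ 2) (Measure.pi fun _ : Fin n => μ) := by
  refine (integrable_exp_scoreSum hv hv1 n (2 * (√n * κ))).mono'
    ((measurable_gaussLik hv κ n).pow_const 2).aestronglyMeasurable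
    (Eventually.of_forall fun x => ?_)
  rw [Real.norm_of_nonneg (sq_nonneg _)]
  exact gaussLik_sq_le μ v κ n x

lemma integrable_gaussLik (hv : Measurable v) (hv1 : ∀ x, v x ∈ Set.Icc (0 : ℝ) 1) (κ : ℝ)
    (n : ℕ) : Integrable (gaussLik μ v κ n) (Measure.pi fun _ : Fin n => μ) := by
  refine ((integrable_gaussLik_sq hv hv1 κ n).add (integrable_const (1 : ℝ))).mono'
    (measurable_gaussLik hv κ n).aestronglyMeasurable (Eventually.of_forall fun x => ?_)
  rw [Real.norm_of_nonneg (gaussLik_pos μ v κ n x).le]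
  simp only [Pi.add_apply]
  nlinarith [sq_nonneg (gaussLik μ v κ n x - 1 / 2)]

lemma integrable_inv_gaussLik (hv : Measurable v) (hv1 : ∀ x, v x ∈ Set.Icc (0 : ℝ) 1) (κ : ℝ)
    (n : ℕ) : Integrable (fun x => (gaussLik μ v κ n x)⁻¹) (Measure.pi fun _ : Fin n => μ) := by
  simp_rw [inv_gaussLik_eq]
  exact (integrable_exp_scoreSum hv hv1 n _).const_mul _

/-- Exponential moments of the normalized sum are bounded, uniformly on compact sets of
exponents. -/
lemma exists_integral_exp_scoreSum_le (hv : Measurable v) (hv1 : ∀ x, v x ∈ Set.Icc (0 : ℝ) 1)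
    (T : ℝ) : ∃ C : ℝ, ∀ᶠ n : ℕ in atTop, ∀ t : ℝ, |t| ≤ T →
      ∫ x, Real.exp (t * scoreSum μ v n x) ∂(Measure.pi fun _ : Fin n => μ) ≤ C := by
  have h := (tendsto_integral_exp_scoreSum (μ := μ) hv hv1 T).add
    (tendsto_integral_exp_scoreSum (μ := μ) hv hv1 (-T))
  refine ⟨_, (h.eventually_le_const (lt_add_one _)).mono fun n hn t ht => le_trans ?_ hn⟩
  have i1 := integrable_exp_scoreSum (μ := μ) hv hv1 n T
  have i2 := integrable_exp_scoreSum (μ := μ) hv hv1 n (-T)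
  rw [← integral_add i1 i2]
  refine integral_mono (integrable_exp_scoreSum hv hv1 n t) (i1.add i2) fun x => ?_
  have hT := abs_le.1 ht
  rcases le_total 0 (scoreSum μ v n x) with hx | hx
  · have : Real.exp (t * scoreSum μ v n x) ≤ Real.exp (T * scoreSum μ v n x) :=
      Real.exp_le_exp.2 (mul_le_mul_of_nonneg_right hT.2 hx)
    linarith [Real.exp_pos (-T * scoreSum μ v n x)]
  · have : Real.exp (t * scoreSum μ v n x) ≤ Real.exp (-T * scoreSum μ v n x) :=
      Real.exp_le_exp.2 (mul_le_mul_of_nonpos_right hT.1 hx)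
    linarith [Real.exp_pos (T * scoreSum μ v n x)]

lemma exists_integral_gaussLik_le (hv : Measurable v) (hv1 : ∀ x, v x ∈ Set.Icc (0 : ℝ) 1)
    {κ : ℕ → ℝ} (hκ : κ =O[atTop] (fun n : ℕ => 1 / √(n : ℝ))) :
    ∃ C : ℝ, ∀ᶠ n : ℕ in atTop,
      ∫ x, gaussLik μ v (κ n) n x ^ 2 ∂(Measure.pi fun _ : Fin n => μ) ≤ C ∧
      ∫ x, (gaussLik μ v (κ n) n x)⁻¹ ∂(Measure.pi fun _ : Fin n => μ) ≤ C := by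
  obtain ⟨T, hT, h⟩ := exists_abs_sqrt_mul_le hκ
  obtain ⟨C, hC⟩ := exists_integral_exp_scoreSum_le (μ := μ) hv hv1 (2 * T)
  refine ⟨max C (Real.exp (T ^ 2 * Var[v; μ] / 2) * C), ?_⟩
  filter_upwards [h, hC] with n hn hCn
  constructor
  · refine le_max_of_le_left (le_trans ?_ (hCn (2 * (√n * κ n)) ?_))
    · exact integral_mono (integrable_gaussLik_sq hv hv1 _ n) (integrable_exp_scoreSum hv hv1 n _)
        fun x => gaussLik_sq_le μ v _ n x
    · rw [abs_mul, abs_two]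
      gcongr
  · refine le_max_of_le_right ?_
    simp_rw [inv_gaussLik_eq]
    rw [integral_const_mul]
    have h1 := hCn (-(√n * κ n)) (by rw [abs_neg]; linarith)
    have h2 : (√n * κ n) ^ 2 ≤ T ^ 2 := by
      rw [← sq_abs]
      gcongr
    have hV := variance_nonneg v μ
    have h3 : 0 ≤ ∫ x, Real.exp (-(√n * κ n) * scoreSum μ v n x)
        ∂(Measure.pi fun _ : Fin n => μ) := integral_nonneg fun _ => (Real.exp_pos _).le
    gcongr

/-- The ratio of the exact to the limiting likelihood ratio converges to one in mean square: its
first two moments are `n`-th powers of `1 + o(1 / n)`. -/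
lemma tendsto_integral_sq_ratio_sub_one (hv : Measurable v)
    (hv1 : ∀ x, v x ∈ Set.Icc (0 : ℝ) 1) {f : ℝ → ℝ} (hf : IsAngularFunction f)
    {κ : ℕ → ℝ} (hκ : κ =O[atTop] (fun n : ℕ => 1 / √(n : ℝ))) :
    (∀ᶠ n : ℕ in atTop, Integrable
      (fun x => (likRatio μ v f (κ n) n x / gaussLik μ v (κ n) n x - 1) ^ 2)
      (Measure.pi fun _ : Fin n => μ)) ∧
    Tendsto (fun n : ℕ => ∫ x, (likRatio μ v f (κ n) n x / gaussLik μ v (κ n) n x - 1) ^ 2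
      ∂(Measure.pi fun _ : Fin n => μ)) atTop (𝓝 0) := by
  set h : ℕ → X → ℝ := fun n x => angDens μ v f (κ n) x / gaussFactor μ v (κ n) x with hdef
  have hm : ∀ n, Measurable (h n) := fun n =>
    (measurable_angDens hv hf _).div (measurable_gaussFactor hv _)
  have hκ0 : Tendsto κ atTop (𝓝 0) := hκ.trans_tendsto tendsto_inv_sqrt_natCast
  have hκ2 : (fun n => κ n ^ 2) =O[atTop] (fun n : ℕ => 1 / (n : ℝ)) := by
    refine (hκ.pow 2).congr_right fun n => ?_
    rw [div_pow, Real.sq_sqrt (Nat.cast_nonneg n), one_pow]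
  have hnn : (fun n : ℕ => (n : ℝ) * (1 / n)) =O[atTop] (fun _ => (1 : ℝ)) := by
    refine IsBigO.of_bound 1 ?_
    filter_upwards [eventually_ge_atTop 1] with n hn
    have : (n : ℝ) ≠ 0 := by positivity
    rw [mul_one_div_cancel this]
    simp
  have hmean : Tendsto (fun n : ℕ => (n : ℝ) * (∫ x, h n x ∂μ - 1)) atTop (𝓝 0) := by
    have h1 := ((integral_ratio_sub_one_isLittleO (μ := μ) hv hv1 hf).comp_tendsto hκ0).trans_isBigO
      hκ2
    have h2 := ((isBigO_refl (fun n : ℕ => (n : ℝ)) atTop).mul_isLittleO h1).trans_isBigO hnn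
    exact (isLittleO_one_iff ℝ).1 h2
  obtain ⟨C, hC, hb⟩ := exists_abs_ratio_sub_one_le (μ := μ) hv hv1 hf
  have hb : ∀ᶠ n in atTop, ∀ x, |h n x - 1| ≤ C * κ n ^ 2 := hκ0.eventually hb
  have hbd : ∀ᶠ n in atTop, ∃ B : ℝ, ∀ x, |h n x| ≤ B := hb.mono fun n hn =>
    ⟨C * κ n ^ 2 + 1, fun x => by
      have := abs_add_le (h n x - 1) 1
      simp only [sub_add_cancel, abs_one] at this
      linarith [hn x]⟩
  have hsq : Tendsto (fun n : ℕ => (n : ℝ) * (∫ x, h n x ^ 2 ∂μ - 1)) atTop (𝓝 0) := by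
    have h3 : Tendsto (fun n : ℕ => (n : ℝ) * ∫ x, (h n x - 1) ^ 2 ∂μ) atTop (𝓝 0) := by
      have h4 : Tendsto (fun n : ℕ => (n : ℝ) * κ n ^ 2 * (C ^ 2 * κ n ^ 2)) atTop (𝓝 0) := by
        have h5 := ((isBigO_refl (fun n : ℕ => (n : ℝ)) atTop).mul hκ2).trans hnn
        have h6 : (fun n => C ^ 2 * κ n ^ 2) =o[atTop] (fun _ => (1 : ℝ)) := by
          rw [isLittleO_one_iff]
          simpa using (hκ0.pow 2).const_mul (C ^ 2)
        simpa using (isLittleO_one_iff ℝ).1 ((h5.mul_isLittleO h6).congr_right fun _ => one_mul 1)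
      refine squeeze_zero' (Eventually.of_forall fun n => mul_nonneg (Nat.cast_nonneg n)
        (integral_nonneg fun x => sq_nonneg _)) ?_ h4
      filter_upwards [hb] with n hn
      have h7 : ∫ x, (h n x - 1) ^ 2 ∂μ ≤ (C * κ n ^ 2) ^ 2 := by
        have := norm_integral_le_of_norm_le_const (μ := μ) (f := fun x => (h n x - 1) ^ 2)
          (C := (C * κ n ^ 2) ^ 2) (Eventually.of_forall fun x => by
            rw [Real.norm_eq_abs, abs_pow]
            exact pow_le_pow_left₀ (abs_nonneg _) (hn x) 2)
        simp only [probReal_univ, mul_one] at this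
        exact (le_abs_self _).trans this
      calc (n : ℝ) * ∫ x, (h n x - 1) ^ 2 ∂μ ≤ n * (C * κ n ^ 2) ^ 2 := by gcongr
        _ = _ := by ring
    have h8 := (hmean.const_mul 2).add h3
    simp only [mul_zero, add_zero] at h8
    refine h8.congr' ?_
    filter_upwards [hbd] with n hn
    obtain ⟨B, hB⟩ := hn
    have i1 : Integrable (h n) μ := integrable_of_abs_le (hm n) hB
    have i2 : Integrable (fun x => h n x ^ 2) μ := integrable_of_abs_le ((hm n).pow_const 2)
      (C := B ^ 2) fun x => by
        rw [abs_pow]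
        exact pow_le_pow_left₀ (abs_nonneg _) (hB x) 2
    have e : ∫ x, (h n x - 1) ^ 2 ∂μ = ∫ x, h n x ^ 2 ∂μ - 2 * ∫ x, h n x ∂μ + 1 := by
      have e0 : ∀ x, (h n x - 1) ^ 2 = h n x ^ 2 - 2 * h n x + 1 := fun x => by ring
      simp_rw [e0]
      exact integral_sub_two_mul_add_one i1 i2
    rw [e]
    ring
  have lim1 := Real.tendsto_one_add_pow_exp_of_tendsto hmean
  have lim2 := Real.tendsto_one_add_pow_exp_of_tendsto hsq
  rw [Real.exp_zero] at lim1 lim2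
  have key : ∀ᶠ n in atTop, Integrable (fun x : Fin n → X => ∏ i, h n (x i)) (Measure.pi fun _ => μ)
      ∧ Integrable (fun x : Fin n → X => ∏ i, h n (x i) ^ 2) (Measure.pi fun _ => μ) := by
    filter_upwards [hbd] with n hn
    obtain ⟨B, hB⟩ := hn
    refine ⟨integrable_prod_of_abs_le (hm n) hB n,
      integrable_prod_of_abs_le ((hm n).pow_const 2) (C := B ^ 2) (fun x => ?_) n⟩
    rw [abs_pow]
    exact pow_le_pow_left₀ (abs_nonneg _) (hB x) 2
  have expand : ∀ n (x : Fin n → X), (likRatio μ v f (κ n) n x / gaussLik μ v (κ n) n x - 1) ^ 2 =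
      ∏ i, h n (x i) ^ 2 - 2 * ∏ i, h n (x i) + 1 := fun n x => by
    rw [likRatio_div_gaussLik, Finset.prod_pow]
    ring
  simp_rw [expand]
  refine ⟨key.mono fun n hn => (hn.2.sub (hn.1.const_mul 2)).add (integrable_const 1), ?_⟩
  have lim := (lim2.sub (lim1.const_mul 2)).add_const 1
  norm_num at lim
  refine lim.congr' ?_
  filter_upwards [key] with n hn
  rw [integral_sub_two_mul_add_one hn.1 hn.2, integral_fintype_prod_eq_pow (h n),
    integral_fintype_prod_eq_pow (fun x => h n x ^ 2)]
  simp

/-- The likelihood ratio and its limiting form are asymptotically equal in `L¹`. -/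
lemma tendsto_integral_abs_likRatio_sub (hv : Measurable v)
    (hv1 : ∀ x, v x ∈ Set.Icc (0 : ℝ) 1) {f : ℝ → ℝ} (hf : IsAngularFunction f)
    {κ : ℕ → ℝ} (hκ : κ =O[atTop] (fun n : ℕ => 1 / √(n : ℝ))) :
    Tendsto (fun n : ℕ => ∫ x, |likRatio μ v f (κ n) n x - gaussLik μ v (κ n) n x|
      ∂(Measure.pi fun _ : Fin n => μ)) atTop (𝓝 0) := by
  obtain ⟨hint, hlim⟩ := tendsto_integral_sq_ratio_sub_one (μ := μ) hv hv1 hf hκ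
  obtain ⟨C, hC⟩ := exists_integral_gaussLik_le (μ := μ) hv hv1 hκ
  refine tendsto_zero_of_forall_le_add (fun n => integral_nonneg fun _ => abs_nonneg _) C
    (fun δ n => δ⁻¹ * ∫ x, (likRatio μ v f (κ n) n x / gaussLik μ v (κ n) n x - 1) ^ 2
      ∂(Measure.pi fun _ : Fin n => μ)) (fun δ _ => by simpa using hlim.const_mul δ⁻¹)
    fun δ hδ => ?_
  filter_upwards [hint, hC] with n hn hCn
  have i1 := (integrable_gaussLik_sq (μ := μ) hv hv1 (κ n) n).const_mul δ
  have i2 := hn.const_mul δ⁻¹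
  calc _ ≤ ∫ x, (δ * gaussLik μ v (κ n) n x ^ 2 +
        δ⁻¹ * (likRatio μ v f (κ n) n x / gaussLik μ v (κ n) n x - 1) ^ 2)
        ∂(Measure.pi fun _ : Fin n => μ) := by
        refine integral_mono ((integrable_likRatio hv hv1 hf _ n).sub
          (integrable_gaussLik hv hv1 _ n)).abs (i1.add i2) fun x => ?_
        have hM := gaussLik_pos μ v (κ n) n x
        set M := gaussLik μ v (κ n) n x
        set L := likRatio μ v f (κ n) n x
        have e : |L - M| = M * |L / M - 1| := by
          rw [← abs_of_pos hM, ← abs_mul, abs_of_pos hM]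
          congr 1
          field_simp
        rw [e, ← sq_abs (L / M - 1)]
        set a := |L / M - 1|
        have e2 : δ * M ^ 2 + δ⁻¹ * a ^ 2 - M * a = δ⁻¹ * ((δ * M - a / 2) ^ 2 + 3 / 4 * a ^ 2) := by
          field_simp
          ring
        have : 0 ≤ δ⁻¹ * ((δ * M - a / 2) ^ 2 + 3 / 4 * a ^ 2) := by positivity
        linarith
    _ = δ * ∫ x, gaussLik μ v (κ n) n x ^ 2 ∂(Measure.pi fun _ : Fin n => μ) + _ := by
        rw [integral_add i1 i2, integral_const_mul, integral_const_mul]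
    _ ≤ _ := by
        gcongr
        exact hCn.1

/-- The likelihood ratio and its limiting form are asymptotically equal in probability, on the
logarithmic scale. -/
lemma isLittleOP_log_likRatio_sub (hv : Measurable v)
    (hv1 : ∀ x, v x ∈ Set.Icc (0 : ℝ) 1) {f : ℝ → ℝ} (hf : IsAngularFunction f)
    {κ : ℕ → ℝ} (hκ : κ =O[atTop] (fun n : ℕ => 1 / √(n : ℝ))) :
    IsLittleOP (fun n => Measure.pi fun _ : Fin n => μ) (fun n x =>
      Real.log (likRatio μ v f (κ n) n x) - Real.log (gaussLik μ v (κ n) n x)) := by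
  intro ε hε
  obtain ⟨hint, hlim⟩ := tendsto_integral_sq_ratio_sub_one (μ := μ) hv hv1 hf hκ
  -- `δ` is chosen such that `|y - 1| < δ` implies both `0 < y` and `|log y| < ε`.
  set δ := 1 - Real.exp (-ε) with hδ
  have hδ0 : 0 < δ := by
    have : Real.exp (-ε) < 1 := by rw [Real.exp_lt_one_iff]; linarith
    linarith
  have hbound : ∀ᶠ n : ℕ in atTop, (Measure.pi fun _ : Fin n => μ)
      {x | ε ≤ |Real.log (likRatio μ v f (κ n) n x) - Real.log (gaussLik μ v (κ n) n x)|} ≤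
      ENNReal.ofReal ((δ ^ 2)⁻¹ * ∫ x, (likRatio μ v f (κ n) n x / gaussLik μ v (κ n) n x - 1) ^ 2
        ∂(Measure.pi fun _ : Fin n => μ)) := by
    filter_upwards [hint] with n hn
    have hsub : {x | ε ≤ |Real.log (likRatio μ v f (κ n) n x) -
        Real.log (gaussLik μ v (κ n) n x)|} ⊆
        {x | δ ^ 2 ≤ (likRatio μ v f (κ n) n x / gaussLik μ v (κ n) n x - 1) ^ 2} := by
      intro x hx
      simp only [Set.mem_ofPred_eq] at hx ⊢
      by_contra! hlt
      have hM := gaussLik_pos μ v (κ n) n x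
      set M := gaussLik μ v (κ n) n x
      set L := likRatio μ v f (κ n) n x
      have habs := abs_lt.1 (abs_lt_of_sq_lt_sq hlt hδ0.le)
      have hy1 : Real.exp (-ε) < L / M := by linarith [habs.1]
      have hy0 : 0 < L / M := (Real.exp_pos _).trans hy1
      have hL : L ≠ 0 := by
        rintro h0
        rw [h0, zero_div] at hy0
        exact lt_irrefl _ hy0
      have hy2 : L / M < Real.exp ε := by
        have h2 : 2 - Real.exp (-ε) ≤ Real.exp ε := by
          have h3 : Real.exp ε * Real.exp (-ε) = 1 := by rw [← Real.exp_add]; simp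
          nlinarith [Real.add_one_le_exp ε, Real.add_one_le_exp (-ε)]
        linarith [habs.2]
      rw [← Real.log_div hL hM.ne'] at hx
      have : |Real.log (L / M)| < ε := by
        rw [abs_lt]
        exact ⟨(Real.lt_log_iff_exp_lt hy0).2 hy1, (Real.log_lt_iff_lt_exp hy0).2 hy2⟩
      linarith
    refine (measure_mono hsub).trans ?_
    have hmk := mul_meas_ge_le_integral_of_nonneg
      (Eventually.of_forall fun x => sq_nonneg
        (likRatio μ v f (κ n) n x / gaussLik μ v (κ n) n x - 1)) hn (δ ^ 2)
    rw [ENNReal.le_ofReal_iff_toReal_le (measure_ne_top _ _)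
      (mul_nonneg (by positivity) (integral_nonneg fun _ => sq_nonneg _)),
      inv_mul_eq_div, le_div_iff₀ (by positivity), mul_comm]
    exact hmk
  have hz : Tendsto (fun n : ℕ => ENNReal.ofReal ((δ ^ 2)⁻¹ *
      ∫ x, (likRatio μ v f (κ n) n x / gaussLik μ v (κ n) n x - 1) ^ 2
        ∂(Measure.pi fun _ : Fin n => μ))) atTop (𝓝 0) := by
    simpa using ENNReal.tendsto_ofReal (hlim.const_mul (δ ^ 2)⁻¹)
  exact tendsto_of_tendsto_of_tendsto_of_le_of_le' tendsto_const_nhds hz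
    (Eventually.of_forall fun _ => zero_le) hbound

end Approximation

section Consequences

variable {X : Type} [MeasurableSpace X]

/-! ### Contiguity -/

lemma integral_angSampleLaw {μ : Measure X} {v : X → ℝ} (hv : Measurable v) {f : ℝ → ℝ}
    (hf : IsAngularFunction f) (κ : ℝ) (n : ℕ) (ψ : (Fin n → X) → ℝ) :
    ∫ x, ψ x ∂(angSampleLaw μ v f κ n) =
      ∫ x, likRatio μ v f κ n x * ψ x ∂(Measure.pi fun _ : Fin n => μ) := by
  rw [angSampleLaw, integral_withDensity_eq_integral_toReal_smul
    (measurable_likRatio hv hf κ n).ennreal_ofReal (Eventually.of_forall fun _ => by simp)]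
  refine integral_congr_ae (Eventually.of_forall fun x => ?_)
  simp only [smul_eq_mul]
  rw [ENNReal.toReal_ofReal (likRatio_nonneg μ v hf κ n x)]

variable {μ : Measure X} [IsProbabilityMeasure μ] {v : X → ℝ}

lemma angSampleLaw_apply (hv : Measurable v) (hv1 : ∀ x, v x ∈ Set.Icc (0 : ℝ) 1) {f : ℝ → ℝ}
    (hf : IsAngularFunction f) (κ : ℝ) (n : ℕ) {A : Set (Fin n → X)} (hA : MeasurableSet A) :
    angSampleLaw μ v f κ n A =
      ENNReal.ofReal (∫ x in A, likRatio μ v f κ n x ∂(Measure.pi fun _ : Fin n => μ)) := by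
  rw [angSampleLaw, withDensity_apply _ hA, ofReal_integral_eq_lintegral_ofReal
    (integrable_likRatio hv hv1 hf κ n).integrableOn
    (Eventually.of_forall fun x => likRatio_nonneg μ v hf κ n x)]

lemma abs_setIntegral_likRatio_sub_le (hv : Measurable v) (hv1 : ∀ x, v x ∈ Set.Icc (0 : ℝ) 1)
    {f : ℝ → ℝ} (hf : IsAngularFunction f) (κ : ℝ) (n : ℕ) (A : Set (Fin n → X)) :
    |∫ x in A, likRatio μ v f κ n x ∂(Measure.pi fun _ : Fin n => μ) -
      ∫ x in A, gaussLik μ v κ n x ∂(Measure.pi fun _ : Fin n => μ)| ≤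
    ∫ x, |likRatio μ v f κ n x - gaussLik μ v κ n x| ∂(Measure.pi fun _ : Fin n => μ) := by
  have i1 := integrable_likRatio (μ := μ) hv hv1 hf κ n
  have i2 := integrable_gaussLik (μ := μ) hv hv1 κ n
  rw [← integral_sub i1.integrableOn i2.integrableOn]
  exact abs_integral_le_integral_abs.trans (setIntegral_le_integral (i1.sub i2).abs
    (Eventually.of_forall fun _ => abs_nonneg _))

/-- Alternatives at distance `O(n^(-1/2))` are contiguous to the null hypothesis, because the
limiting likelihood ratio is bounded in mean square. -/
lemma isContiguous_angSampleLaw (hv : Measurable v) (hv1 : ∀ x, v x ∈ Set.Icc (0 : ℝ) 1)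
    {f : ℝ → ℝ} (hf : IsAngularFunction f) {κ : ℕ → ℝ}
    (hκ : κ =O[atTop] (fun n : ℕ => 1 / √(n : ℝ))) :
    IsContiguous (fun n => angSampleLaw μ v f (κ n) n) (fun n => Measure.pi fun _ : Fin n => μ) := by
  intro A hA hlim
  simp_rw [fun n => angSampleLaw_apply (μ := μ) hv hv1 hf (κ n) n (hA n)]
  rw [← ENNReal.ofReal_zero]
  refine ENNReal.tendsto_ofReal ?_
  have hreal : Tendsto (fun n => (Measure.pi fun _ : Fin n => μ).real (A n)) atTop (𝓝 0) :=
    (ENNReal.tendsto_toReal_zero_iff (fun n => measure_ne_top _ _)).2 hlim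
  obtain ⟨C, hC⟩ := exists_integral_gaussLik_le (μ := μ) hv hv1 hκ
  have hL := tendsto_integral_abs_likRatio_sub (μ := μ) hv hv1 hf hκ
  refine tendsto_zero_of_forall_le_add
    (fun n => integral_nonneg fun x => likRatio_nonneg μ v hf _ n x) C
    (fun δ n => δ⁻¹ * (Measure.pi fun _ : Fin n => μ).real (A n) +
      ∫ x, |likRatio μ v f (κ n) n x - gaussLik μ v (κ n) n x| ∂(Measure.pi fun _ : Fin n => μ))
    (fun δ _ => by simpa using (hreal.const_mul δ⁻¹).add hL) fun δ hδ => ?_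
  filter_upwards [hC] with n hn
  have h1 := (abs_le.1 (abs_setIntegral_likRatio_sub_le (μ := μ) hv hv1 hf (κ n) n (A n))).2
  have i2 := integrable_gaussLik_sq (μ := μ) hv hv1 (κ n) n
  have h2 : ∫ x in A n, gaussLik μ v (κ n) n x ∂(Measure.pi fun _ : Fin n => μ) ≤
      δ * C + δ⁻¹ * (Measure.pi fun _ : Fin n => μ).real (A n) := by
    calc _ ≤ ∫ x in A n, (δ * gaussLik μ v (κ n) n x ^ 2 + δ⁻¹)
          ∂(Measure.pi fun _ : Fin n => μ) := by
          refine integral_mono (integrable_gaussLik hv hv1 _ n).integrableOn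
            ((i2.const_mul δ).integrableOn.add (integrable_const _)) fun x => ?_
          set M := gaussLik μ v (κ n) n x
          have e2 : δ * M ^ 2 + δ⁻¹ - M = δ⁻¹ * ((δ * M - 1 / 2) ^ 2 + 3 / 4) := by
            field_simp
            ring
          have : 0 ≤ δ⁻¹ * ((δ * M - 1 / 2) ^ 2 + 3 / 4) := by positivity
          linarith
      _ = δ * ∫ x in A n, gaussLik μ v (κ n) n x ^ 2 ∂(Measure.pi fun _ : Fin n => μ) +
          δ⁻¹ * (Measure.pi fun _ : Fin n => μ).real (A n) := by
          rw [integral_add (i2.const_mul δ).integrableOn (integrable_const _), integral_const_mul]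
          simp [mul_comm]
      _ ≤ _ := by
          gcongr
          exact (setIntegral_le_integral i2 (Eventually.of_forall fun _ => sq_nonneg _)).trans hn.1
  linarith

/-- The null hypothesis is contiguous to alternatives at distance `O(n^(-1/2))`, because the inverse
of the limiting likelihood ratio is bounded in mean. -/
lemma isContiguous_pi_angSampleLaw (hv : Measurable v) (hv1 : ∀ x, v x ∈ Set.Icc (0 : ℝ) 1)
    {f : ℝ → ℝ} (hf : IsAngularFunction f) {κ : ℕ → ℝ}
    (hκ : κ =O[atTop] (fun n : ℕ => 1 / √(n : ℝ))) :
    IsContiguous (fun n => Measure.pi fun _ : Fin n => μ) (fun n => angSampleLaw μ v f (κ n) n) := by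
  intro A hA hlim
  simp_rw [fun n => angSampleLaw_apply (μ := μ) hv hv1 hf (κ n) n (hA n)] at hlim
  refine (ENNReal.tendsto_toReal_zero_iff (fun n => measure_ne_top _ _)).1 ?_
  have hreal : Tendsto (fun n => ∫ x in A n, likRatio μ v f (κ n) n x
      ∂(Measure.pi fun _ : Fin n => μ)) atTop (𝓝 0) := by
    refine ((ENNReal.tendsto_toReal_zero_iff (fun n => ENNReal.ofReal_ne_top)).2 hlim).congr
      fun n => ENNReal.toReal_ofReal (integral_nonneg fun x => likRatio_nonneg μ v hf _ n x)
  obtain ⟨C, hC⟩ := exists_integral_gaussLik_le (μ := μ) hv hv1 hκ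
  have hL := tendsto_integral_abs_likRatio_sub (μ := μ) hv hv1 hf hκ
  refine tendsto_zero_of_forall_le_add (fun n => ENNReal.toReal_nonneg) C
    (fun δ n => δ⁻¹ * (∫ x in A n, likRatio μ v f (κ n) n x ∂(Measure.pi fun _ : Fin n => μ) +
      ∫ x, |likRatio μ v f (κ n) n x - gaussLik μ v (κ n) n x| ∂(Measure.pi fun _ : Fin n => μ)))
    (fun δ _ => by simpa using (hreal.add hL).const_mul δ⁻¹) fun δ hδ => ?_
  filter_upwards [hC] with n hn
  have h1 := (abs_le.1 (abs_setIntegral_likRatio_sub_le (μ := μ) hv hv1 hf (κ n) n (A n))).1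
  have i1 := integrable_gaussLik (μ := μ) hv hv1 (κ n) n
  have i2 := integrable_inv_gaussLik (μ := μ) hv hv1 (κ n) n
  calc ((Measure.pi fun _ : Fin n => μ) (A n)).toReal
      = ∫ _ in A n, (1 : ℝ) ∂(Measure.pi fun _ : Fin n => μ) := by
        simp [Measure.real]
    _ ≤ ∫ x in A n, (δ * (gaussLik μ v (κ n) n x)⁻¹ + δ⁻¹ * gaussLik μ v (κ n) n x)
        ∂(Measure.pi fun _ : Fin n => μ) := by
        refine integral_mono (integrable_const _)
          ((i2.const_mul δ).integrableOn.add (i1.const_mul δ⁻¹).integrableOn) fun x => ?_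
        have hM := gaussLik_pos μ v (κ n) n x
        set M := gaussLik μ v (κ n) n x
        have e2 : δ * M⁻¹ + δ⁻¹ * M - 1 = δ⁻¹ * M⁻¹ * ((δ - M / 2) ^ 2 + 3 / 4 * M ^ 2) := by
          field_simp
          ring
        have : 0 ≤ δ⁻¹ * M⁻¹ * ((δ - M / 2) ^ 2 + 3 / 4 * M ^ 2) := by positivity
        linarith
    _ = δ * ∫ x in A n, (gaussLik μ v (κ n) n x)⁻¹ ∂(Measure.pi fun _ : Fin n => μ) +
        δ⁻¹ * ∫ x in A n, gaussLik μ v (κ n) n x ∂(Measure.pi fun _ : Fin n => μ) := by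
        rw [integral_add (i2.const_mul δ).integrableOn (i1.const_mul δ⁻¹).integrableOn,
          integral_const_mul, integral_const_mul]
    _ ≤ _ := by
        gcongr
        · exact (setIntegral_le_integral i2 (Eventually.of_forall fun x =>
            (inv_pos.2 (gaussLik_pos μ v (κ n) n x)).le)).trans hn.2
        · linarith

/-! ### Power of tests under local alternatives -/

lemma IsTestSequence.integrable {Ω : ℕ → Type} [∀ n, MeasurableSpace (Ω n)] {φ : ∀ n, Ω n → ℝ}
    (hφ : IsTestSequence φ) (n : ℕ) (ν : Measure (Ω n)) [IsFiniteMeasure ν] :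
    Integrable (φ n) ν :=
  integrable_of_abs_le (hφ n).1 (C := 1) fun x => by
    have := (hφ n).2 x
    rw [abs_le]; constructor <;> linarith [this.1, this.2]

lemma IsTestSequence.integrable_mul {Ω : ℕ → Type} [∀ n, MeasurableSpace (Ω n)]
    {φ : ∀ n, Ω n → ℝ} (hφ : IsTestSequence φ) {n : ℕ} {ν : Measure (Ω n)} {F : Ω n → ℝ}
    (hF : Integrable F ν) : Integrable (fun x => F x * φ n x) ν :=
  hF.mul_bdd (c := 1) (hφ n).1.aestronglyMeasurable (Eventually.of_forall fun x => by
    have := (hφ n).2 x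
    rw [Real.norm_eq_abs, abs_le]; constructor <;> linarith [this.1, this.2])

/-- The power of a sequence of tests may be computed with the limiting likelihood ratio. -/
lemma tendsto_integral_angSampleLaw_sub (hv : Measurable v)
    (hv1 : ∀ x, v x ∈ Set.Icc (0 : ℝ) 1) {f : ℝ → ℝ} (hf : IsAngularFunction f) {κ : ℕ → ℝ}
    (hκ : κ =O[atTop] (fun n : ℕ => 1 / √(n : ℝ))) {φ : ∀ n, (Fin n → X) → ℝ}
    (hφ : IsTestSequence φ) :
    Tendsto (fun n => ∫ x, φ n x ∂(angSampleLaw μ v f (κ n) n) -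
      ∫ x, gaussLik μ v (κ n) n x * φ n x ∂(Measure.pi fun _ : Fin n => μ)) atTop (𝓝 0) := by
  refine squeeze_zero_norm (fun n => ?_) (tendsto_integral_abs_likRatio_sub (μ := μ) hv hv1 hf hκ)
  have i1 := integrable_likRatio (μ := μ) hv hv1 hf (κ n) n
  have i2 := integrable_gaussLik (μ := μ) hv hv1 (κ n) n
  rw [integral_angSampleLaw hv hf, ← integral_sub (hφ.integrable_mul i1) (hφ.integrable_mul i2)]
  refine norm_integral_le_of_norm_le (i1.sub i2).abs (Eventually.of_forall fun x => ?_)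
  have := (hφ n).2 x
  rw [← sub_mul, norm_mul, Real.norm_eq_abs, Real.norm_of_nonneg this.1]
  exact mul_le_of_le_one_right (abs_nonneg _) this.2

/-- An asymptotic Neyman-Pearson lemma: tests that reject for large values of the limiting
likelihood ratio, with bounded critical values, are asymptotically most powerful. -/
lemma eventually_power_le_of_threshold (hv : Measurable v)
    (hv1 : ∀ x, v x ∈ Set.Icc (0 : ℝ) 1) {f : ℝ → ℝ} (hf : IsAngularFunction f) {κ : ℕ → ℝ}
    (hκ : κ =O[atTop] (fun n : ℕ => 1 / √(n : ℝ))) {φ ψ : ∀ n, (Fin n → X) → ℝ}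
    (hφ : IsTestSequence φ) (hψ : IsTestSequence ψ) {α : ℝ}
    (hlevel : Tendsto (fun n => ∫ x, φ n x ∂(Measure.pi fun _ : Fin n => μ)) atTop (𝓝 α))
    (hψα : ∀ ε : ℝ, 0 < ε → ∀ᶠ n in atTop,
      ∫ x, ψ n x ∂(Measure.pi fun _ : Fin n => μ) ≤ α + ε)
    {K : ℝ} (hK : ∀ᶠ n in atTop, ∃ k ∈ Set.Icc 0 K, ∀ x,
      (k < gaussLik μ v (κ n) n x → φ n x = 1) ∧ (gaussLik μ v (κ n) n x < k → φ n x = 0))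
    {ε : ℝ} (hε : 0 < ε) : ∀ᶠ n in atTop, ∫ x, ψ n x ∂(angSampleLaw μ v f (κ n) n) ≤
      ∫ x, φ n x ∂(angSampleLaw μ v f (κ n) n) + ε := by
  have hφM := tendsto_integral_angSampleLaw_sub (μ := μ) hv hv1 hf hκ hφ
  have hψM := tendsto_integral_angSampleLaw_sub (μ := μ) hv hv1 hf hκ hψ
  have hdiff := hψM.sub hφM
  rw [sub_zero] at hdiff
  set η := ε / (4 * (|K| + 1)) with hη
  have hη0 : 0 < η := by positivity
  have hηK : |K| * (2 * η) ≤ ε / 2 := by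
    calc |K| * (2 * η) ≤ (|K| + 1) * (2 * η) := by gcongr; linarith
      _ = ε / 2 := by rw [hη]; field_simp; norm_num
  filter_upwards [hdiff.eventually_lt_const (half_pos hε), hψα η hη0,
    hlevel.eventually_const_lt (sub_lt_self α hη0), hK] with n h1 h2 h3 h4
  obtain ⟨k, hk, hkx⟩ := h4
  have iM := integrable_gaussLik (μ := μ) hv hv1 (κ n) n
  have jφ := hφ.integrable n (Measure.pi fun _ : Fin n => μ)
  have jψ := hψ.integrable n (Measure.pi fun _ : Fin n => μ)
  have jφM := hφ.integrable_mul iM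
  have jψM := hψ.integrable_mul iM
  have key : ∫ x, gaussLik μ v (κ n) n x * ψ n x ∂(Measure.pi fun _ : Fin n => μ) -
      ∫ x, gaussLik μ v (κ n) n x * φ n x ∂(Measure.pi fun _ : Fin n => μ) ≤
      k * (∫ x, ψ n x ∂(Measure.pi fun _ : Fin n => μ) -
        ∫ x, φ n x ∂(Measure.pi fun _ : Fin n => μ)) := by
    rw [← integral_sub jψM jφM, ← integral_sub jψ jφ, ← integral_const_mul]
    refine integral_mono (jψM.sub jφM) ((jψ.sub jφ).const_mul k) fun x => ?_
    have hψx := (hψ n).2 x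
    rcases lt_trichotomy k (gaussLik μ v (κ n) n x) with h | h | h
    · rw [(hkx x).1 h]
      nlinarith [hψx.2]
    · rw [← h]
      linarith
    · rw [(hkx x).2 h]
      nlinarith [hψx.1]
  have hlast : k * (∫ x, ψ n x ∂(Measure.pi fun _ : Fin n => μ) -
        ∫ x, φ n x ∂(Measure.pi fun _ : Fin n => μ)) ≤ |K| * (2 * η) := by
    have a1 : ∫ x, ψ n x ∂(Measure.pi fun _ : Fin n => μ) -
        ∫ x, φ n x ∂(Measure.pi fun _ : Fin n => μ) ≤ 2 * η := by linarith
    calc _ ≤ k * (2 * η) := mul_le_mul_of_nonneg_left a1 hk.1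
      _ ≤ |K| * (2 * η) := by
        gcongr
        exact hk.2.trans (le_abs_self K)
  linarith

lemma tendsto_integral_indicator_of_isAsymptoticallyNormal {Ω : ℕ → Type}
    [∀ n, MeasurableSpace (Ω n)] {P : ∀ n, Measure (Ω n)} {T : ∀ n, Ω n → ℝ}
    (hTm : ∀ n, Measurable (T n)) (hT : IsAsymptoticallyNormal P T 1) {α z : ℝ}
    (hz : cdf (gaussianReal 0 1) z = 1 - α) :
    Tendsto (fun n => ∫ x, Set.indicator {x | z < T n x} (fun _ => (1 : ℝ)) x ∂(P n))
      atTop (𝓝 α) := by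
  obtain ⟨-, hP, hT⟩ := hT
  have hone : (1 : ℝ).toNNReal = 1 := Real.toNNReal_one
  have hfr : (gaussianReal 0 1) (frontier (Set.Ioi z)) = 0 := by
    have := nullSingletonClass_gaussianReal (μ := 0) (v := 1) one_ne_zero
    rw [frontier_Ioi]
    exact measure_singleton z
  have h := ProbabilityMeasure.tendsto_measure_of_null_frontier_of_tendsto' hT.tendsto
    (E := Set.Ioi z) (by simpa [hone] using hfr)
  have hval : (gaussianReal 0 1).real (Set.Ioi z) = α := by
    rw [← Set.compl_Iic, probReal_compl_eq_one_sub measurableSet_Iic, ← cdf_eq_real, hz]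
    ring
  have h1 : Tendsto (fun n => (P n).map (T n) (Set.Ioi z)) atTop
      (𝓝 (gaussianReal 0 1 (Set.Ioi z))) := by
    simpa [hone] using h
  have h2 := (ENNReal.tendsto_toReal (measure_ne_top _ _)).comp h1
  rw [← hval]
  refine h2.congr fun n => ?_
  have hms : MeasurableSet {x | z < T n x} := measurableSet_lt measurable_const (hTm n)
  rw [integral_indicator hms]
  simp only [Function.comp]
  rw [Measure.map_apply (hTm n) measurableSet_Ioi]
  simp only [setIntegral_const, smul_eq_mul, mul_one]
  rfl

/-- The test based on a standardized multiple of the normalized sum is asymptotically most powerful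
against local alternatives on the side given by the sign of the multiple. -/
lemma isAsymptoticallyMostPowerful_scoreSum (hv : Measurable v)
    (hv1 : ∀ x, v x ∈ Set.Icc (0 : ℝ) 1) {a : ℝ} (ha : a ^ 2 * Var[v; μ] = 1)
    {A : Set (∀ n, Measure (Fin n → X))}
    (hA : ∀ Q ∈ A, ∃ f : ℝ → ℝ, IsAngularFunction f ∧ ∃ κ : ℕ → ℝ,
      κ =O[atTop] (fun n : ℕ => 1 / √(n : ℝ)) ∧ (∀ n, 1 ≤ n → 0 < κ n / a) ∧
      Q = fun n => angSampleLaw μ v f (κ n) n)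
    {α z : ℝ} (hz : cdf (gaussianReal 0 1) z = 1 - α) :
    IsAsymptoticallyMostPowerful (fun n => Measure.pi fun _ : Fin n => μ) A α
      (fun n => Set.indicator {x | z < a * scoreSum μ v n x} (fun _ => (1 : ℝ))) := by
  have ha0 : a ≠ 0 := by
    rintro rfl
    simp at ha
  have hm : ∀ n, Measurable (fun x => a * scoreSum μ v n x) := fun n =>
    (measurable_scoreSum hv n).const_mul a
  have hms : ∀ n, MeasurableSet {x | z < a * scoreSum μ v n x} := fun n =>
    measurableSet_lt measurable_const (hm n)
  have htest : IsTestSequence (fun n => Set.indicator {x | z < a * scoreSum μ v n x}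
      (fun _ => (1 : ℝ))) := fun n => ⟨measurable_const.indicator (hms n), fun x =>
    ⟨Set.indicator_nonneg (fun _ _ => zero_le_one) x,
      Set.indicator_le_self' (fun _ _ => zero_le_one) x⟩⟩
  have hnormal := isAsymptoticallyNormal_const_mul_scoreSum (μ := μ) hv hv1 a
  rw [ha] at hnormal
  have hlevel := tendsto_integral_indicator_of_isAsymptoticallyNormal hm hnormal hz
  refine ⟨htest, hlevel, ?_⟩
  intro ψ hψ hψα Q hQ ε hε
  obtain ⟨f, hf, κ, hκ, hpos, rfl⟩ := hA Q hQ
  obtain ⟨T, hT, hTb⟩ := exists_abs_sqrt_mul_le hκ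
  refine eventually_power_le_of_threshold (K := Real.exp (T / |a| * |z|)) hv hv1 hf hκ htest hψ
    hlevel hψα ?_ hε
  filter_upwards [hTb, eventually_ge_atTop 1] with n hn hn1
  have hsq : 0 < √(n : ℝ) := Real.sqrt_pos.2 (by exact_mod_cast hn1)
  set r := √n * κ n / a with hr
  have hr0 : 0 < r := by
    rw [hr, mul_div_assoc]
    exact mul_pos hsq (hpos n hn1)
  have hrT : r ≤ T / |a| := by
    rw [← abs_of_pos hr0, hr, abs_div]
    gcongr
  have hra : √n * κ n = r * a := by
    rw [hr]
    field_simp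
  refine ⟨Real.exp (r * z - (√n * κ n) ^ 2 * Var[v; μ] / 2), ⟨(Real.exp_pos _).le, ?_⟩, ?_⟩
  · rw [Real.exp_le_exp]
    have h1 : 0 ≤ (√n * κ n) ^ 2 * Var[v; μ] := mul_nonneg (sq_nonneg _) (variance_nonneg v μ)
    have h2 : r * z ≤ T / |a| * |z| := by
      calc r * z ≤ r * |z| := by gcongr; exact le_abs_self z
        _ ≤ _ := by gcongr
    linarith
  · intro x
    rw [gaussLik_eq_exp, Real.exp_lt_exp, Real.exp_lt_exp, sub_lt_sub_iff_right,
      sub_lt_sub_iff_right, hra, mul_assoc, mul_lt_mul_iff_right₀ hr0, mul_lt_mul_iff_right₀ hr0]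
    refine ⟨fun h => Set.indicator_of_mem (by exact h) _, fun h => Set.indicator_of_notMem ?_ _⟩
    exact fun h' => lt_asymm h h'

/-- Detection at rate `n^(-1/2)`: a test whose rejection probability is a small sinusoidal
perturbation of `α` has level tending to `α`, and the shift of the normalized sum under the
alternative moves the phase by a quarter period. -/
lemma exists_test_power_gt (hv : Measurable v) (hv1 : ∀ x, v x ∈ Set.Icc (0 : ℝ) 1) {f : ℝ → ℝ}
    (hf : IsAngularFunction f) (hV : 0 < Var[v; μ]) {τ : ℝ} (hτ : τ ≠ 0) {α : ℝ}
    (hα : α ∈ Set.Ioo (0 : ℝ) 1) :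
    ∃ φ : ∀ n, (Fin n → X) → ℝ, IsTestSequence φ ∧
      Tendsto (fun n => ∫ x, φ n x ∂(Measure.pi fun _ : Fin n => μ)) atTop (𝓝 α) ∧
      ∃ β ∈ Set.Ioo α 1, Tendsto
        (fun n : ℕ => ∫ x, φ n x ∂(angSampleLaw μ v f (τ * (1 / √n)) n)) atTop (𝓝 β) := by
  set V := Var[v; μ] with hVdef
  set η := min α (1 - α) with hη
  have hη0 : 0 < η := lt_min hα.1 (by linarith [hα.2])
  set ω := Real.pi / (2 * τ * V) with hω
  have hω0 : ω ≠ 0 := by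
    have := Real.pi_pos
    have := hV.ne'
    rw [hω]
    positivity
  set φ : ∀ n, (Fin n → X) → ℝ := fun n x => α + η * Real.sin (ω * scoreSum μ v n x) with hφ
  have hsin_m : ∀ n, Measurable (fun x => Real.sin (ω * scoreSum μ v n x)) := fun n =>
    Real.measurable_sin.comp ((measurable_scoreSum hv n).const_mul ω)
  have hsin_1 : ∀ n (x : Fin n → X), |Real.sin (ω * scoreSum μ v n x)| ≤ 1 := fun n x =>
    Real.abs_sin_le_one _
  have htest : IsTestSequence φ := fun n => by
    refine ⟨((hsin_m n).const_mul η).const_add α, fun x => ?_⟩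
    have h1 := abs_le.1 (hsin_1 n x)
    have h2 : η ≤ α := min_le_left _ _
    have h3 : η ≤ 1 - α := min_le_right _ _
    constructor <;> simp only [hφ] <;> nlinarith
  -- The imaginary part of the exponential moment at `t + iω`.
  have him : ∀ t : ℝ, Tendsto (fun n : ℕ => ∫ x, Real.exp (t * scoreSum μ v n x) *
      Real.sin (ω * scoreSum μ v n x) ∂(Measure.pi fun _ : Fin n => μ)) atTop
      (𝓝 (Real.exp ((t ^ 2 - ω ^ 2) * V / 2) * Real.sin (t * ω * V))) := fun t => by
    have h := (Complex.continuous_im.tendsto _).comp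
      (tendsto_integral_cexp_scoreSum (μ := μ) hv hv1 (t + ω * Complex.I))
    have e : (t + ω * Complex.I) ^ 2 * (V : ℂ) / 2 =
        ((t ^ 2 - ω ^ 2) * V / 2 : ℝ) + (t * ω * V : ℝ) * Complex.I := by
      push_cast
      linear_combination ((ω : ℂ) ^ 2 * V / 2) * Complex.I_sq
    rw [e, Complex.exp_im] at h
    simp only [Complex.add_re, Complex.ofReal_re, Complex.mul_re, Complex.I_re, mul_zero,
      Complex.ofReal_im, Complex.I_im, mul_one, sub_self, add_zero, Complex.add_im, Complex.mul_im,
      zero_add] at h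
    refine h.congr fun n => ?_
    simp only [Function.comp]
    obtain ⟨C, hC⟩ := exists_abs_scoreSum_le (μ := μ) hv hv1 n
    have hint : Integrable (fun x => Complex.exp ((t + ω * Complex.I) * scoreSum μ v n x))
        (Measure.pi fun _ : Fin n => μ) := by
      refine (integrable_exp_scoreSum hv hv1 n t).mono' ?_ (Eventually.of_forall fun x => ?_)
      · have := measurable_scoreSum (μ := μ) hv n
        exact Measurable.aestronglyMeasurable (by fun_prop)
      · rw [Complex.norm_exp]
        simp
    have := integral_im hint
    simp only [RCLike.im_to_complex] at this
    rw [← this]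
    refine integral_congr_ae (Eventually.of_forall fun x => ?_)
    simp only
    rw [Complex.exp_im]
    simp
  have hM := fun t : ℝ => tendsto_integral_exp_scoreSum (μ := μ) hv hv1 t
  have isin : ∀ n (t : ℝ), Integrable (fun x => Real.exp (t * scoreSum μ v n x) *
      Real.sin (ω * scoreSum μ v n x)) (Measure.pi fun _ : Fin n => μ) := fun n t =>
    (integrable_exp_scoreSum hv hv1 n t).mul_bdd (c := 1) (hsin_m n).aestronglyMeasurable
      (Eventually.of_forall (hsin_1 n))
  have hφlim : ∀ t : ℝ, Tendsto (fun n : ℕ => ∫ x, Real.exp (t * scoreSum μ v n x) * φ n x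
      ∂(Measure.pi fun _ : Fin n => μ)) atTop (𝓝 (α * Real.exp (t ^ 2 * V / 2) +
        η * (Real.exp ((t ^ 2 - ω ^ 2) * V / 2) * Real.sin (t * ω * V)))) := fun t => by
    refine (((hM t).const_mul α).add ((him t).const_mul η)).congr fun n => ?_
    rw [← integral_const_mul, ← integral_const_mul,
      ← integral_add ((integrable_exp_scoreSum hv hv1 n t).const_mul α) ((isin n t).const_mul η)]
    refine integral_congr_ae (Eventually.of_forall fun x => ?_)
    simp only [hφ]
    ring
  refine ⟨φ, htest, ?_, α + η * Real.exp (-(ω ^ 2 * V / 2)), ⟨?_, ?_⟩, ?_⟩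
  · simpa using hφlim 0
  · have := mul_pos hη0 (Real.exp_pos (-(ω ^ 2 * V / 2)))
    linarith
  · have h1 : Real.exp (-(ω ^ 2 * V / 2)) < 1 := by
      rw [Real.exp_lt_one_iff]
      have : 0 < ω ^ 2 * V / 2 := by positivity
      linarith
    have h2 : η ≤ 1 - α := min_le_right _ _
    nlinarith
  · have hκ : (fun n : ℕ => τ * (1 / √(n : ℝ))) =O[atTop] (fun n : ℕ => 1 / √(n : ℝ)) :=
      isBigO_const_mul_self _ _ _
    have h1 := tendsto_integral_angSampleLaw_sub (μ := μ) hv hv1 hf hκ htest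
    have h2 := (hφlim τ).const_mul (Real.exp (-(τ ^ 2 * V / 2)))
    have hphase : τ * ω * V = Real.pi / 2 := by
      rw [hω]
      field_simp
    have e : Real.exp (-(τ ^ 2 * V / 2)) * (α * Real.exp (τ ^ 2 * V / 2) +
        η * (Real.exp ((τ ^ 2 - ω ^ 2) * V / 2) * Real.sin (τ * ω * V))) =
        α + η * Real.exp (-(ω ^ 2 * V / 2)) := by
      have e1 : Real.exp (-(τ ^ 2 * V / 2)) * Real.exp (τ ^ 2 * V / 2) = 1 := by
        rw [← Real.exp_add]; simp
      have e2 : Real.exp (-(τ ^ 2 * V / 2)) * Real.exp ((τ ^ 2 - ω ^ 2) * V / 2) =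
          Real.exp (-(ω ^ 2 * V / 2)) := by
        rw [← Real.exp_add]; ring_nf
      rw [hphase, Real.sin_pi_div_two]
      linear_combination α * e1 + η * e2
    rw [e] at h2
    have h3 := h1.add h2
    rw [zero_add] at h3
    refine h3.congr' ?_
    filter_upwards [eventually_ge_atTop 1] with n hn
    have hsq : √(n : ℝ) ≠ 0 := (Real.sqrt_pos.2 (by exact_mod_cast hn)).ne'
    have hc : √(n : ℝ) * (τ * (1 / √n)) = τ := by field_simp
    have e3 : ∀ x : Fin n → X, gaussLik μ v (τ * (1 / √n)) n x * φ n x =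
        Real.exp (-(τ ^ 2 * V / 2)) * (Real.exp (τ * scoreSum μ v n x) * φ n x) := fun x => by
      rw [gaussLik_eq_exp, hc, ← hVdef, ← mul_assoc, ← Real.exp_add]
      ring_nf
    simp_rw [e3]
    rw [integral_const_mul]
    ring

end Consequences

/-! ### The uniform distribution on the sphere and its moments -/

section Sphere

variable {p : ℕ}

instance isFiniteMeasure_surfaceMeasure : IsFiniteMeasure (surfaceMeasure p) := by
  unfold surfaceMeasure
  infer_instance

lemma surfaceMeasure_univ_ne_zero (hp : 2 ≤ p) : surfaceMeasure p Set.univ ≠ 0 := by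
  rw [Measure.measure_univ_ne_zero, surfaceMeasure, Ne, Measure.toSphere_eq_zero_iff_finrank,
    finrank_euclideanSpace_fin]
  omega

lemma isProbabilityMeasure_uniformLaw (hp : 2 ≤ p) : IsProbabilityMeasure (uniformLaw p) :=
  ⟨by
    rw [uniformLaw, Measure.smul_apply, smul_eq_mul]
    exact ENNReal.inv_mul_cancel (surfaceMeasure_univ_ne_zero hp) (measure_ne_top _ _)⟩

/-- The restriction of a linear isometry to the unit sphere. -/
def sphereMap (e : EuclideanSpace ℝ (Fin p) ≃ₗᵢ[ℝ] EuclideanSpace ℝ (Fin p)) (x : UnitSphere p) :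
    UnitSphere p := ⟨e x, by simp⟩

lemma measurable_sphereMap (e : EuclideanSpace ℝ (Fin p) ≃ₗᵢ[ℝ] EuclideanSpace ℝ (Fin p)) :
    Measurable (sphereMap e) :=
  (e.continuous.measurable.comp measurable_subtype_coe).subtype_mk

open scoped Pointwise in
lemma measurePreserving_sphereMap
    (e : EuclideanSpace ℝ (Fin p) ≃ₗᵢ[ℝ] EuclideanSpace ℝ (Fin p)) :
    MeasurePreserving (sphereMap e) (surfaceMeasure p) (surfaceMeasure p) := by
  refine ⟨measurable_sphereMap e, ?_⟩
  ext s hs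
  rw [Measure.map_apply (measurable_sphereMap e) hs, surfaceMeasure,
    Measure.toSphere_apply' _ (measurable_sphereMap e hs), Measure.toSphere_apply' _ hs]
  congr 1
  have : Set.Ioo (0 : ℝ) 1 • (((↑) : UnitSphere p → EuclideanSpace ℝ (Fin p)) ''
      (sphereMap e ⁻¹' s)) = e ⁻¹' (Set.Ioo (0 : ℝ) 1 •
        (((↑) : UnitSphere p → EuclideanSpace ℝ (Fin p)) '' s)) := by
    ext y
    simp only [Set.mem_smul, Set.mem_image, Set.mem_preimage]
    constructor
    · rintro ⟨r, hr, _, ⟨x, hx, rfl⟩, rfl⟩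
      exact ⟨r, hr, _, ⟨_, hx, rfl⟩, by simp [sphereMap]⟩
    · rintro ⟨r, hr, _, ⟨x, hx, rfl⟩, h⟩
      refine ⟨r, hr, _, ⟨sphereMap e.symm x, ?_, rfl⟩, ?_⟩
      · have : sphereMap e (sphereMap e.symm x) = x := by
          ext1
          simp [sphereMap]
        rwa [this]
      · apply e.injective
        rw [← h]
        simp [sphereMap]
  rw [this]
  exact e.measurePreserving.measure_preimage_equiv (f := e.toHomeomorph.toMeasurableEquiv) _

/-- The moments of the projections of the uniform distribution do not depend on the direction. -/
lemma integral_inner_pow_eq (u w : EuclideanSpace ℝ (Fin p)) (hu : ‖u‖ = 1) (hw : ‖w‖ = 1)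
    (k : ℕ) : ∫ x : UnitSphere p, inner ℝ (x : EuclideanSpace ℝ (Fin p)) u ^ k ∂(uniformLaw p) =
      ∫ x : UnitSphere p, inner ℝ (x : EuclideanSpace ℝ (Fin p)) w ^ k ∂(uniformLaw p) := by
  set e := (Submodule.span ℝ {u - w})ᗮ.reflection with he
  have heu : e u = w := Submodule.reflection_sub (hu.trans hw.symm)
  have hmp : MeasurePreserving (sphereMap e) (uniformLaw p) (uniformLaw p) :=
    (measurePreserving_sphereMap e).smul_measure _
  have hm : AEStronglyMeasurable
      (fun x : UnitSphere p => inner ℝ (x : EuclideanSpace ℝ (Fin p)) w ^ k)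
      (Measure.map (sphereMap e) (uniformLaw p)) :=
    (Continuous.measurable (by fun_prop)).aestronglyMeasurable
  rw [← hmp.map_eq, integral_map hmp.aemeasurable hm, hmp.map_eq]
  refine integral_congr_ae (Eventually.of_forall fun x => ?_)
  simp only [sphereMap]
  rw [← heu, e.inner_map_map]

lemma integrable_of_continuous_sphere {F : UnitSphere p → ℝ} (hF : Continuous F)
    (ν : Measure (UnitSphere p)) [IsFiniteMeasure ν] : Integrable F ν := by
  obtain ⟨C, hC⟩ := isCompact_univ.exists_bound_of_continuousOn hF.continuousOn
  exact Integrable.of_bound hF.measurable.aestronglyMeasurable C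
    (Eventually.of_forall fun x => hC x (Set.mem_univ x))

lemma sum_inner_sq_eq_one (x : UnitSphere p) :
    ∑ i, inner ℝ (x : EuclideanSpace ℝ (Fin p)) (EuclideanSpace.basisFun (Fin p) ℝ i) ^ 2 = 1 := by
  have h := (EuclideanSpace.basisFun (Fin p) ℝ).sum_sq_norm_inner_left
    (x : EuclideanSpace ℝ (Fin p))
  have hx : ‖(x : EuclideanSpace ℝ (Fin p))‖ = 1 := by simp
  rw [hx, one_pow] at h
  simpa using h

lemma integral_inner_sq (hp : 2 ≤ p) (θ : UnitSphere p) :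
    ∫ x : UnitSphere p, inner ℝ (x : EuclideanSpace ℝ (Fin p)) θ ^ 2 ∂(uniformLaw p) =
      1 / (p : ℝ) := by
  have := isProbabilityMeasure_uniformLaw hp
  have hp0 : (p : ℝ) ≠ 0 := by positivity
  set b := EuclideanSpace.basisFun (Fin p) ℝ
  have h1 : ∑ i, ∫ x : UnitSphere p, inner ℝ (x : EuclideanSpace ℝ (Fin p)) (b i) ^ 2
      ∂(uniformLaw p) = 1 := by
    rw [← integral_finsetSum _ fun i _ => integrable_of_continuous_sphere (by fun_prop) _]
    simp_rw [b, sum_inner_sq_eq_one]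
    simp
  rw [Finset.sum_congr rfl fun i _ => integral_inner_pow_eq (b i) θ (by simp [b]) (by simp) 2] at h1
  simp only [Finset.sum_const, Finset.card_univ, Fintype.card_fin, nsmul_eq_mul] at h1
  field_simp
  linarith

/-- Invariance under the rotation by `π / 4` in the plane of two orthonormal vectors relates the
mixed to the pure fourth moments. -/
lemma integral_inner_sq_mul_inner_sq (hp : 2 ≤ p) (a b θ : EuclideanSpace ℝ (Fin p)) (ha : ‖a‖ = 1)
    (hb : ‖b‖ = 1) (hθ : ‖θ‖ = 1) (hab : inner ℝ a b = 0) :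
    ∫ x : UnitSphere p, inner ℝ (x : EuclideanSpace ℝ (Fin p)) a ^ 2 *
      inner ℝ (x : EuclideanSpace ℝ (Fin p)) b ^ 2 ∂(uniformLaw p) =
    (∫ x : UnitSphere p, inner ℝ (x : EuclideanSpace ℝ (Fin p)) θ ^ 4 ∂(uniformLaw p)) / 3 := by
  have := isProbabilityMeasure_uniformLaw hp
  have h2 : (√2 : ℝ) ^ 2 = 2 := Real.sq_sqrt (by norm_num)
  have h4 : ((√2 : ℝ)⁻¹) ^ 4 = 1 / 4 := by
    rw [inv_pow, show (√2 : ℝ) ^ 4 = (√2 ^ 2) ^ 2 by ring, h2]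
    norm_num
  have hunit : ∀ c : ℝ, c ^ 2 = 1 → ‖(√2 : ℝ)⁻¹ • (a + c • b)‖ = 1 := fun c hc => by
    have : ‖a + c • b‖ ^ 2 = 2 := by
      rw [norm_add_sq_real, norm_smul, mul_pow, inner_smul_right, hab, ha, hb, Real.norm_eq_abs,
        sq_abs, hc]
      norm_num
    rw [norm_smul, norm_inv, Real.norm_of_nonneg (Real.sqrt_nonneg 2),
      ← Real.sqrt_sq (norm_nonneg (a + c • b)), this]
    exact inv_mul_cancel₀ (by positivity)
  set I := fun u : EuclideanSpace ℝ (Fin p) =>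
    ∫ x : UnitSphere p, inner ℝ (x : EuclideanSpace ℝ (Fin p)) u ^ 4 ∂(uniformLaw p) with hI
  have hint : ∀ {F : UnitSphere p → ℝ}, Continuous F → Integrable F (uniformLaw p) :=
    fun h => integrable_of_continuous_sphere h _
  have e1 : I ((√2 : ℝ)⁻¹ • (a + (1 : ℝ) • b)) + I ((√2 : ℝ)⁻¹ • (a + (-1 : ℝ) • b)) =
      (1 / 2) * I a + (1 / 2) * I b + 3 * ∫ x : UnitSphere p,
        inner ℝ (x : EuclideanSpace ℝ (Fin p)) a ^ 2 *
        inner ℝ (x : EuclideanSpace ℝ (Fin p)) b ^ 2 ∂(uniformLaw p) := by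
    simp only [hI]
    rw [← integral_add (hint (by fun_prop)) (hint (by fun_prop)), ← integral_const_mul,
      ← integral_const_mul, ← integral_const_mul,
      ← integral_add (hint (by fun_prop)) (hint (by fun_prop)),
      ← integral_add (hint (by fun_prop)) (hint (by fun_prop))]
    refine integral_congr_ae (Eventually.of_forall fun x => ?_)
    simp only [inner_smul_right, inner_add_right, mul_pow, h4]
    ring
  have hIθ : ∀ u, ‖u‖ = 1 → I u = I θ := fun u hu => integral_inner_pow_eq u θ hu hθ 4
  rw [hIθ _ (hunit 1 (by norm_num)), hIθ _ (hunit (-1) (by norm_num)), hIθ a ha, hIθ b hb] at e1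
  change _ = I θ / 3
  linarith

lemma integral_inner_pow_four (hp : 2 ≤ p) (θ : UnitSphere p) :
    ∫ x : UnitSphere p, inner ℝ (x : EuclideanSpace ℝ (Fin p)) θ ^ 4 ∂(uniformLaw p) =
      3 / ((p : ℝ) * (p + 2)) := by
  have := isProbabilityMeasure_uniformLaw hp
  have hp0 : (p : ℝ) ≠ 0 := by positivity
  set b := EuclideanSpace.basisFun (Fin p) ℝ
  set m := ∫ x : UnitSphere p, inner ℝ (x : EuclideanSpace ℝ (Fin p)) θ ^ 4 ∂(uniformLaw p) with hm
  have hij : ∀ i j, ∫ x : UnitSphere p, inner ℝ (x : EuclideanSpace ℝ (Fin p)) (b i) ^ 2 *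
      inner ℝ (x : EuclideanSpace ℝ (Fin p)) (b j) ^ 2 ∂(uniformLaw p) =
      m / 3 + if i = j then 2 * m / 3 else 0 := fun i j => by
    split_ifs with h
    · subst h
      have : ∀ x : UnitSphere p, inner ℝ (x : EuclideanSpace ℝ (Fin p)) (b i) ^ 2 *
          inner ℝ (x : EuclideanSpace ℝ (Fin p)) (b i) ^ 2 =
          inner ℝ (x : EuclideanSpace ℝ (Fin p)) (b i) ^ 4 := fun x => by ring
      simp_rw [this]
      rw [integral_inner_pow_eq (b i) θ (by simp [b]) (by simp) 4, ← hm]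
      ring
    · rw [integral_inner_sq_mul_inner_sq hp (b i) (b j) θ (by simp [b]) (by simp [b]) (by simp)
        (b.orthonormal.2 h), add_zero]
  -- Integrate `(∑ i, x_i²)² = 1`.
  have h1 : ∑ i, ∑ j, ∫ x : UnitSphere p, inner ℝ (x : EuclideanSpace ℝ (Fin p)) (b i) ^ 2 *
      inner ℝ (x : EuclideanSpace ℝ (Fin p)) (b j) ^ 2 ∂(uniformLaw p) = 1 := by
    have hin : ∀ i, ∑ j, ∫ x : UnitSphere p, inner ℝ (x : EuclideanSpace ℝ (Fin p)) (b i) ^ 2 *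
        inner ℝ (x : EuclideanSpace ℝ (Fin p)) (b j) ^ 2 ∂(uniformLaw p) =
        ∫ x : UnitSphere p, inner ℝ (x : EuclideanSpace ℝ (Fin p)) (b i) ^ 2 ∂(uniformLaw p) := by
      intro i
      rw [← integral_finsetSum _ fun j _ => integrable_of_continuous_sphere (by fun_prop) _]
      simp_rw [← Finset.mul_sum, b, sum_inner_sq_eq_one, mul_one]
    simp_rw [hin]
    rw [← integral_finsetSum _ fun i _ => integrable_of_continuous_sphere (by fun_prop) _]
    simp_rw [b, sum_inner_sq_eq_one]
    simp
  simp_rw [hij, Finset.sum_add_distrib] at h1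
  simp at h1
  have hp2 : (p : ℝ) + 2 ≠ 0 := by positivity
  field_simp at h1 ⊢
  linarith

/-- The squared projection on the axis `θ`. -/
def axialStat (θ : UnitSphere p) (x : UnitSphere p) : ℝ :=
  inner ℝ (x : EuclideanSpace ℝ (Fin p)) θ ^ 2

lemma continuous_axialStat (θ : UnitSphere p) : Continuous (axialStat θ) := by
  unfold axialStat
  fun_prop

lemma axialStat_mem_Icc (θ x : UnitSphere p) : axialStat θ x ∈ Set.Icc (0 : ℝ) 1 := by
  refine ⟨sq_nonneg _, ?_⟩
  rw [axialStat, ← sq_abs]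
  refine pow_le_one₀ (abs_nonneg _) ((abs_real_inner_le_norm _ _).trans ?_)
  simp

lemma sq_mul_variance_axialStat (hp : 2 ≤ p) (θ : UnitSphere p) :
    (p : ℝ) ^ 2 * Var[axialStat θ; uniformLaw p] = fisherInfo p := by
  have := isProbabilityMeasure_uniformLaw hp
  rw [variance_eq_of_mem_Icc (continuous_axialStat θ).measurable (axialStat_mem_Icc θ)]
  have h4 : ∀ x, axialStat θ x ^ 2 = inner ℝ (x : EuclideanSpace ℝ (Fin p)) θ ^ 4 := fun x => by
    rw [axialStat]
    ring
  simp_rw [h4]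
  simp only [axialStat]
  rw [integral_inner_pow_four hp, integral_inner_sq hp, fisherInfo]
  have hp0 : (p : ℝ) ≠ 0 := by positivity
  have hp2 : (p : ℝ) + 2 ≠ 0 := by positivity
  field_simp
  ring

lemma fisherInfo_pos (hp : 2 ≤ p) : 0 < fisherInfo p := by
  have : (2 : ℝ) ≤ p := by exact_mod_cast hp
  unfold fisherInfo
  have h1 : 0 < (p : ℝ) - 1 := by linarith
  positivity

/-! ### The axial model as a family of densities of the squared projection -/

lemma exists_axialStat_eq_zero (hp : 2 ≤ p) (θ : UnitSphere p) : ∃ x, axialStat θ x = 0 := by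
  have hne : (Submodule.span ℝ {(θ : EuclideanSpace ℝ (Fin p))})ᗮ ≠ ⊥ := by
    intro h
    rw [Submodule.orthogonal_eq_bot_iff] at h
    have h1 := finrank_span_singleton (K := ℝ) (v := (θ : EuclideanSpace ℝ (Fin p)))
      (by rw [← norm_pos_iff]; simp)
    rw [h, finrank_top, finrank_euclideanSpace_fin] at h1
    omega
  obtain ⟨y, hy, hy0⟩ := Submodule.exists_mem_ne_zero_of_ne_bot hne
  have hn : ‖y‖ ≠ 0 := norm_ne_zero_iff.2 hy0
  refine ⟨⟨‖y‖⁻¹ • y, by simp [norm_smul, hn]⟩, ?_⟩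
  have := Submodule.mem_orthogonal_singleton_iff_inner_left.1 hy
  simp [axialStat, inner_smul_left, this]

lemma integrable_comp_mul_axialStat (ν : Measure (UnitSphere p)) [IsFiniteMeasure ν]
    (θ : UnitSphere p) {f : ℝ → ℝ} (hf : IsAngularFunction f) (κ : ℝ) :
    Integrable (fun x => f (κ * axialStat θ x)) ν :=
  integrable_of_abs_le (C := f |κ|)
    (hf.monotone.measurable.comp ((continuous_axialStat θ).measurable.const_mul κ)) fun x => by
      rw [abs_of_nonneg (hf.nonneg _)]
      exact hf.monotone ((le_abs_self _).trans (abs_mul_le_of_mem_Icc (axialStat_mem_Icc θ x)))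

/-- The density of the axial law can be normalized: even if `f` vanishes on a half-line, it is
positive near `0`, that is, for directions nearly orthogonal to `θ`. -/
lemma angNorm_axialStat_pos (hp : 2 ≤ p) (θ : UnitSphere p) {f : ℝ → ℝ} (hf : IsAngularFunction f)
    (κ : ℝ) : 0 < angNorm (uniformLaw p) (axialStat θ) f κ := by
  have := isProbabilityMeasure_uniformLaw hp
  have hint := integrable_comp_mul_axialStat (uniformLaw p) θ hf κ
  rw [angNorm, integral_pos_iff_support_of_nonneg (fun x => hf.nonneg _) hint]
  obtain ⟨b, hb⟩ := hf.exists_expansion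
  have hpos : ∀ᶠ x in 𝓝 (0 : ℝ), 0 < f x :=
    (isLittleO_tendsto_one hb).eventually_const_lt one_pos
  obtain ⟨x₀, hx₀⟩ := exists_axialStat_eq_zero hp θ
  have hcont : Tendsto (fun x => κ * axialStat θ x) (𝓝 x₀) (𝓝 0) := by
    have := ((continuous_axialStat θ).const_mul κ).tendsto x₀
    simpa [hx₀] using this
  have hopen : (surfaceMeasure p).IsOpenPosMeasure := by
    unfold surfaceMeasure
    infer_instance
  have hmem : Function.support (fun x => f (κ * axialStat θ x)) ∈ 𝓝 x₀ :=
    (hcont.eventually hpos).mono fun x hx => hx.ne'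
  rw [uniformLaw, Measure.smul_apply, smul_eq_mul]
  exact ENNReal.mul_pos (ENNReal.inv_ne_zero.2 (measure_ne_top _ _))
    (Measure.measure_pos_of_mem_nhds _ hmem).ne'

lemma axialLaw_eq_withDensity (hp : 2 ≤ p) (θ : UnitSphere p) {f : ℝ → ℝ}
    (hf : IsAngularFunction f) (κ : ℝ) : axialLaw θ κ f = (uniformLaw p).withDensity
      fun x => ENNReal.ofReal (angDens (uniformLaw p) (axialStat θ) f κ x) := by
  have := isProbabilityMeasure_uniformLaw hp
  set c := surfaceMeasure p Set.univ with hc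
  have hc0 : c ≠ 0 := surfaceMeasure_univ_ne_zero hp
  have hct : c ≠ ∞ := measure_ne_top _ _
  have hsurf : surfaceMeasure p = c • uniformLaw p := by
    rw [uniformLaw, smul_smul, ENNReal.mul_inv_cancel hc0 hct, one_smul]
  have hm : Measurable fun x => f (κ * axialStat θ x) :=
    hf.monotone.measurable.comp ((continuous_axialStat θ).measurable.const_mul κ)
  have hint := integrable_comp_mul_axialStat (uniformLaw p) θ hf κ
  have hnorm : ∫⁻ y, axialWeight θ κ f y ∂(surfaceMeasure p) =
      c * ENNReal.ofReal (angNorm (uniformLaw p) (axialStat θ) f κ) := by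
    rw [hsurf, lintegral_smul_measure, smul_eq_mul, angNorm, ofReal_integral_eq_lintegral_ofReal hint
      (Eventually.of_forall fun x => hf.nonneg _)]
    rfl
  have hpos := angNorm_axialStat_pos hp θ hf κ
  have hw : Measurable (axialWeight θ κ f) := hm.ennreal_ofReal
  rw [axialLaw, hnorm, hsurf, withDensity_smul_measure, ← withDensity_smul _ (hw.div_const _)]
  congr 1
  ext1 x
  simp only [Pi.smul_apply, smul_eq_mul]
  rw [angDens, ENNReal.ofReal_div_of_pos hpos, ← mul_div_assoc, ENNReal.mul_div_mul_left _ _ hc0 hct]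
  rfl

/-- Independent observations with a density have the product density. -/
lemma pi_withDensity_ofReal {X : Type} [MeasurableSpace X] {μ : Measure X} [IsProbabilityMeasure μ]
    {g : X → ℝ} (hg : Integrable g μ) (hg0 : ∀ x, 0 ≤ g x) (n : ℕ) :
    (Measure.pi fun _ : Fin n => μ.withDensity fun x => ENNReal.ofReal (g x)) =
      (Measure.pi fun _ : Fin n => μ).withDensity fun x => ENNReal.ofReal (∏ i, g (x i)) := by
  have : IsFiniteMeasure (μ.withDensity fun x => ENNReal.ofReal (g x)) :=
    isFiniteMeasure_withDensity_ofReal hg.2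
  refine Measure.pi_eq fun s hs => ?_
  have hms : MeasurableSet (Set.univ.pi s) := MeasurableSet.univ_pi hs
  have hprod : Integrable (fun x : Fin n → X => ∏ i, g (x i)) (Measure.pi fun _ => μ) :=
    Integrable.fintype_prod fun _ => hg
  rw [withDensity_apply _ hms, ← ofReal_integral_eq_lintegral_ofReal hprod.integrableOn
    (Eventually.of_forall fun x => Finset.prod_nonneg fun i _ => hg0 _), ← integral_indicator hms]
  have hind : ∀ x : Fin n → X, (Set.univ.pi s).indicator (fun x => ∏ i, g (x i)) x =
      ∏ i, (s i).indicator g (x i) := fun x => by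
    by_cases hx : x ∈ Set.univ.pi s
    · rw [Set.indicator_of_mem hx]
      exact Finset.prod_congr rfl fun i _ => (Set.indicator_of_mem (hx i (Set.mem_univ i)) g).symm
    · rw [Set.indicator_of_notMem hx]
      simp only [Set.mem_pi, Set.mem_univ, true_implies, not_forall] at hx
      obtain ⟨i, hi⟩ := hx
      exact (Finset.prod_eq_zero (Finset.mem_univ i) (Set.indicator_of_notMem hi g)).symm
  simp_rw [hind]
  rw [integral_fintype_prod_eq_prod (fun i => (s i).indicator g), ENNReal.ofReal_prod_of_nonneg
    fun i _ => integral_nonneg fun x => Set.indicator_nonneg (fun _ _ => hg0 _) x]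
  refine Finset.prod_congr rfl fun i _ => ?_
  rw [integral_indicator (hs i), withDensity_apply _ (hs i),
    ofReal_integral_eq_lintegral_ofReal hg.integrableOn (Eventually.of_forall fun x => hg0 x)]

lemma sampleLaw_eq_angSampleLaw (hp : 2 ≤ p) (θ : UnitSphere p) {f : ℝ → ℝ}
    (hf : IsAngularFunction f) (n : ℕ) (κ : ℝ) :
    sampleLaw θ f n κ = angSampleLaw (uniformLaw p) (axialStat θ) f κ n := by
  have := isProbabilityMeasure_uniformLaw hp
  rw [sampleLaw, angSampleLaw]
  split_ifs with h
  · subst h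
    simp [likRatio, angDens, angNorm, hf.map_zero, nullLaw]
  · rw [axialLaw_eq_withDensity hp θ hf κ]
    exact pi_withDensity_ofReal (integrable_of_abs_le
      (measurable_angDens (continuous_axialStat θ).measurable hf κ)
      (abs_angDens_le (axialStat_mem_Icc θ) hf κ))
      (angDens_nonneg _ _ hf κ) n

lemma isProbabilityMeasure_sampleLaw (hp : 2 ≤ p) (θ : UnitSphere p) {f : ℝ → ℝ}
    (hf : IsAngularFunction f) (n : ℕ) (κ : ℝ) : IsProbabilityMeasure (sampleLaw θ f n κ) := by
  have := isProbabilityMeasure_uniformLaw hp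
  rw [sampleLaw_eq_angSampleLaw hp θ hf]
  refine ⟨?_⟩
  rw [angSampleLaw_apply (continuous_axialStat θ).measurable (axialStat_mem_Icc θ) hf κ n
    MeasurableSet.univ, setIntegral_univ]
  simp only [likRatio]
  rw [integral_fintype_prod_eq_pow (angDens (uniformLaw p) (axialStat θ) f κ)]
  simp only [angDens]
  rw [integral_div]
  have : ∫ x, f (κ * axialStat θ x) ∂(uniformLaw p) = angNorm (uniformLaw p) (axialStat θ) f κ := rfl
  rw [this, div_self (angNorm_axialStat_pos hp θ hf κ).ne']
  simp

/-! ### The central sequence -/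

lemma centralSequence_eq (hp : 2 ≤ p) (θ : UnitSphere p) (n : ℕ) (x : Fin n → UnitSphere p) :
    centralSequence θ n x = p * scoreSum (uniformLaw p) (axialStat θ) n x := by
  have : ∫ y, axialStat θ y ∂(uniformLaw p) = 1 / (p : ℝ) := integral_inner_sq hp θ
  rw [scoreSum, this, centralSequence, div_eq_mul_inv, mul_assoc]
  rfl

lemma dotProduct_sampleCov_mulVec (θ : UnitSphere p) {n : ℕ} (x : Fin n → UnitSphere p) :
    (θ : EuclideanSpace ℝ (Fin p)).ofLp ⬝ᵥ
      (sampleCov x *ᵥ (θ : EuclideanSpace ℝ (Fin p)).ofLp) =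
    (n : ℝ)⁻¹ * ∑ i, inner ℝ (x i : EuclideanSpace ℝ (Fin p)) θ ^ 2 := by
  rw [sampleCov, Matrix.smul_mulVec, dotProduct_smul, Matrix.sum_mulVec, dotProduct_sum, smul_eq_mul]
  congr 1
  refine Finset.sum_congr rfl fun i _ => ?_
  have h : inner ℝ (x i : EuclideanSpace ℝ (Fin p)) (θ : EuclideanSpace ℝ (Fin p)) =
      (θ : EuclideanSpace ℝ (Fin p)).ofLp ⬝ᵥ (x i : EuclideanSpace ℝ (Fin p)).ofLp := by
    simp [EuclideanSpace.inner_eq_star_dotProduct]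
  rw [Matrix.vecMulVec_mulVec, h]
  simp [dotProduct_smul, dotProduct_comm, sq]

lemma centralSequence_eq_sampleCov (hp : 2 ≤ p) (θ : UnitSphere p) (n : ℕ)
    (x : Fin n → UnitSphere p) : centralSequence θ n x =
      √(n : ℝ) * (p * ((θ : EuclideanSpace ℝ (Fin p)).ofLp ⬝ᵥ
        (sampleCov x *ᵥ (θ : EuclideanSpace ℝ (Fin p)).ofLp)) - 1) := by
  rw [dotProduct_sampleCov_mulVec, centralSequence, Finset.sum_sub_distrib]
  rcases Nat.eq_zero_or_pos n with rfl | hn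
  · simp
  · have hp0 : (p : ℝ) ≠ 0 := by positivity
    have hn0 : (n : ℝ) ≠ 0 := by positivity
    have hs : √(n : ℝ) ≠ 0 := by positivity
    have hsq : √(n : ℝ) ^ 2 = n := Real.sq_sqrt (Nat.cast_nonneg n)
    simp only [Finset.sum_const, Finset.card_univ, Fintype.card_fin, nsmul_eq_mul]
    field_simp
    rw [hsq]

/-! ### Local asymptotic normality and the one-sided tests -/

lemma localParameter_isBigO {τ : ℕ → ℝ} (hτ : τ =O[atTop] (fun _ => (1 : ℝ))) (p : ℕ) :
    (fun n : ℕ => τ n * p / √(n : ℝ)) =O[atTop] (fun n : ℕ => 1 / √(n : ℝ)) := by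
  refine ((hτ.mul (isBigO_const_one ℝ (p : ℝ) atTop)).mul
    (isBigO_refl (fun n : ℕ => 1 / √(n : ℝ)) atTop)).congr (fun n => ?_) (fun n => ?_)
  · ring
  · ring

/-- The local asymptotic expansion of the log-likelihood ratio. -/
lemma isLittleOP_llr_sampleLaw (hp : 2 ≤ p) (θ : UnitSphere p) {f : ℝ → ℝ}
    (hf : IsAngularFunction f) {τ : ℕ → ℝ} (hτ : τ =O[atTop] (fun _ => (1 : ℝ))) :
    IsLittleOP (fun n => nullLaw p n) (fun n x =>
      llr (sampleLaw θ f n (τ n * p / √(n : ℝ))) (nullLaw p n) x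
        - (τ n * centralSequence θ n x - (τ n) ^ 2 / 2 * fisherInfo p)) := by
  have := isProbabilityMeasure_uniformLaw hp
  have hvm := (continuous_axialStat θ).measurable
  intro ε hε
  have h := isLittleOP_log_likRatio_sub (μ := uniformLaw p) hvm (axialStat_mem_Icc θ) hf
    (localParameter_isBigO hτ p) ε hε
  refine h.congr' ?_
  filter_upwards [eventually_ge_atTop 1] with n hn
  have hs : √(n : ℝ) ≠ 0 := (Real.sqrt_pos.2 (by exact_mod_cast hn)).ne'
  have hc : √(n : ℝ) * (τ n * p / √n) = τ n * p := by field_simp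
  refine measure_congr ?_
  have hrn : (sampleLaw θ f n (τ n * p / √(n : ℝ))).rnDeriv (nullLaw p n) =ᵐ[nullLaw p n]
      fun x => ENNReal.ofReal (likRatio (uniformLaw p) (axialStat θ) f (τ n * p / √n) n x) := by
    rw [sampleLaw_eq_angSampleLaw hp θ hf]
    have : IsProbabilityMeasure (nullLaw p n) := by unfold nullLaw; infer_instance
    exact Measure.rnDeriv_withDensity _ (measurable_likRatio hvm hf _ n).ennreal_ofReal
  filter_upwards [hrn] with x hx
  have e : llr (sampleLaw θ f n (τ n * p / √(n : ℝ))) (nullLaw p n) x =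
      Real.log (likRatio (uniformLaw p) (axialStat θ) f (τ n * p / √n) n x) := by
    rw [llr, hx, ENNReal.toReal_ofReal (likRatio_nonneg _ _ hf _ n x)]
  have e2 : Real.log (gaussLik (uniformLaw p) (axialStat θ) (τ n * p / √n) n x) =
      τ n * centralSequence θ n x - (τ n) ^ 2 / 2 * fisherInfo p := by
    rw [gaussLik_eq_exp, Real.log_exp, hc, centralSequence_eq hp, ← sq_mul_variance_axialStat hp θ]
    ring
  refine propext ?_
  change ε ≤ |_| ↔ ε ≤ |_|
  rw [e, e2]

lemma isAsymptoticallyNormal_centralSequence (hp : 2 ≤ p) (θ : UnitSphere p) :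
    IsAsymptoticallyNormal (fun n => nullLaw p n) (centralSequence θ) (fisherInfo p) := by
  have := isProbabilityMeasure_uniformLaw hp
  have h := isAsymptoticallyNormal_const_mul_scoreSum (μ := uniformLaw p)
    (continuous_axialStat θ).measurable (axialStat_mem_Icc θ) p
  rw [sq_mul_variance_axialStat hp] at h
  simp_rw [← centralSequence_eq hp] at h
  exact h

lemma variance_axialStat_pos (hp : 2 ≤ p) (θ : UnitSphere p) :
    0 < Var[axialStat θ; uniformLaw p] := by
  have h := sq_mul_variance_axialStat hp θ
  have hΓ := fisherInfo_pos hp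
  rw [← h] at hΓ
  exact pos_of_mul_pos_right hΓ (sq_nonneg _)

lemma isContiguityRateAtZero_sampleLaw (hp : 2 ≤ p) (θ : UnitSphere p) {f : ℝ → ℝ}
    (hf : IsAngularFunction f) :
    IsContiguityRateAtZero (sampleLaw θ f) (fun n => 1 / √(n : ℝ)) := by
  have := isProbabilityMeasure_uniformLaw hp
  have hvm := (continuous_axialStat θ).measurable
  have h0 : ∀ n, sampleLaw θ f n 0 = Measure.pi fun _ => uniformLaw p := fun n => if_pos rfl
  constructor
  · intro κ hκ
    simp_rw [h0, sampleLaw_eq_angSampleLaw hp θ hf]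
    exact ⟨isContiguous_angSampleLaw hvm (axialStat_mem_Icc θ) hf hκ,
      isContiguous_pi_angSampleLaw hvm (axialStat_mem_Icc θ) hf hκ⟩
  · intro τ hτ α hα
    simp_rw [h0, sampleLaw_eq_angSampleLaw hp θ hf]
    exact exists_test_power_gt hvm (axialStat_mem_Icc θ) hf (variance_axialStat_pos hp θ) hτ hα

/-- The one-sided tests, rejecting for large values of `σ T` with a sign `σ`, are asymptotically most
powerful against local alternatives with parameters of that sign. -/
lemma isAsymptoticallyMostPowerful_testStat (hp : 2 ≤ p) (θ : UnitSphere p) {σ : ℝ}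
    (hσ : σ ^ 2 = 1) {s : Set ℝ} (hs : ∀ t ∈ s, 0 < σ * t) {α z : ℝ}
    (hz : cdf (gaussianReal 0 1) z = 1 - α) :
    IsAsymptoticallyMostPowerful (fun n => nullLaw p n) (localAlternatives θ s) α
      (fun n => Set.indicator {x | z < σ * testStat θ n x} (fun _ => (1 : ℝ))) := by
  have := isProbabilityMeasure_uniformLaw hp
  have hΓ := fisherInfo_pos hp
  have hΓ' : 0 < √(fisherInfo p) := Real.sqrt_pos.2 hΓ
  have hp0 : (0 : ℝ) < p := by positivity
  have ha : (σ * (p / √(fisherInfo p))) ^ 2 * Var[axialStat θ; uniformLaw p] = 1 := by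
    rw [mul_pow, hσ, div_pow, Real.sq_sqrt hΓ.le, one_mul, div_mul_eq_mul_div,
      sq_mul_variance_axialStat hp, div_self hΓ.ne']
  have hσ0 : σ ≠ 0 := by
    rintro rfl
    norm_num at hσ
  have e : ∀ n (x : Fin n → UnitSphere p), σ * testStat θ n x =
      σ * (p / √(fisherInfo p)) * scoreSum (uniformLaw p) (axialStat θ) n x := fun n x => by
    rw [testStat, centralSequence_eq hp]
    ring
  simp_rw [e]
  refine isAsymptoticallyMostPowerful_scoreSum (continuous_axialStat θ).measurable
    (axialStat_mem_Icc θ) ha ?_ hz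
  rintro Q ⟨f, hf, τ, hτ, hτs, rfl⟩
  refine ⟨f, hf, _, localParameter_isBigO hτ p, fun n hn => ?_,
    funext fun n => sampleLaw_eq_angSampleLaw hp θ hf n _⟩
  have hsq : 0 < √(n : ℝ) := Real.sqrt_pos.2 (by exact_mod_cast hn)
  have h1 := hs _ (hτs n)
  have e2 : τ n * p / √n / (σ * (p / √(fisherInfo p))) =
      σ * τ n * √(fisherInfo p) / √n / σ ^ 2 := by
    field_simp
  rw [e2, hσ]
  positivity

end Sphere

end

theorem mainTheorem2 (p : ℕ) (hp : 2 ≤ p) (θ : UnitSphere p) (f : ℝ → ℝ)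
    (hf : IsAngularFunction f) :
    -- the expansion of the log-likelihood ratio under the null
    (∀ τ : ℕ → ℝ, τ =O[atTop] (fun _ => (1 : ℝ)) → ¬ τ =o[atTop] (fun _ => (1 : ℝ)) →
      IsLittleOP (fun n => nullLaw p n) (fun n x =>
        llr (sampleLaw θ f n (τ n * p / √(n : ℝ))) (nullLaw p n) x
          - (τ n * centralSequence θ n x - (τ n) ^ 2 / 2 * fisherInfo p))) ∧
    -- asymptotic normality of the central sequence under the null
    IsAsymptoticallyNormal (fun n => nullLaw p n) (centralSequence θ) (fisherInfo p) ∧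
    -- local asymptotic normality at zero, with contiguity rate `1 / √n`
    IsLANAtZero (sampleLaw θ f) (fun n => p / √(n : ℝ)) (centralSequence θ) (fisherInfo p) ∧
    IsContiguityRateAtZero (sampleLaw θ f) (fun n => 1 / √(n : ℝ)) ∧
    -- the central sequence is a function of `θ' S_n θ`
    (∀ (n : ℕ) (x : Fin n → UnitSphere p), centralSequence θ n x =
      √(n : ℝ) * (p * ((θ : EuclideanSpace ℝ (Fin p)).ofLp ⬝ᵥ
        (sampleCov x *ᵥ (θ : EuclideanSpace ℝ (Fin p)).ofLp)) - 1)) ∧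
    -- the locally asymptotically most powerful one-sided tests
    (∀ α ∈ Set.Ioo (0 : ℝ) 1, ∀ z : ℝ, cdf (gaussianReal 0 1) z = 1 - α →
      IsAsymptoticallyMostPowerful (fun n => nullLaw p n) (localAlternatives θ (Set.Ioi 0)) α
          (fun n => Set.indicator {x | z < testStat θ n x} (fun _ => (1 : ℝ))) ∧
      IsAsymptoticallyMostPowerful (fun n => nullLaw p n) (localAlternatives θ (Set.Iio 0)) α
          (fun n => Set.indicator {x | testStat θ n x < -z} (fun _ => (1 : ℝ)))) := by
  have h0 : ∀ n, sampleLaw θ f n 0 = nullLaw p n := fun n => if_pos rfl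
  refine ⟨fun τ hτ _ => isLittleOP_llr_sampleLaw hp θ hf hτ,
    isAsymptoticallyNormal_centralSequence hp θ,
    ⟨isProbabilityMeasure_sampleLaw hp θ hf, fun τ hτ => ?_, ?_⟩,
    isContiguityRateAtZero_sampleLaw hp θ hf, centralSequence_eq_sampleCov hp θ,
    fun α _ z hz => ⟨?_, ?_⟩⟩
  · have e : ∀ n : ℕ, (p : ℝ) / √(n : ℝ) * τ n = τ n * p / √(n : ℝ) := fun n => by ring
    simp only [h0, e]
    exact isLittleOP_llr_sampleLaw hp θ hf hτ
  · simp_rw [h0]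
    exact isAsymptoticallyNormal_centralSequence hp θ
  · have h := isAsymptoticallyMostPowerful_testStat hp θ (σ := 1) (s := Set.Ioi 0) (by norm_num)
      (fun t ht => by rw [one_mul]; exact ht) hz
    simpa only [one_mul] using h
  · have h := isAsymptoticallyMostPowerful_testStat hp θ (σ := -1) (s := Set.Iio 0) (by norm_num)
      (fun t ht => by rw [neg_one_mul]; exact neg_pos.2 ht) hz
    have e : ∀ n (x : Fin n → UnitSphere p), z < -1 * testStat θ n x ↔ testStat θ n x < -z :=
      fun n x => by rw [neg_one_mul, lt_neg]
    simp_rw [e] at h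
    exact h
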